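/- Let $K$ be a field of characteristic zero, $\partial = d/dx$ and $\int : x^n\mapsto x^{n+1}/(n+1)$ on $K[x]$. Let $A_1=K\langle x,\partial\rangle\subseteq \mathbb I_1=K\langle x,\partial,\int\rangle\subseteq \mathrm{End}_K(K[x])$ be the first Weyl algebra and the algebra of polynomial integro-differential operators, let $e_{ij}=\int^i\partial^j-\int^{i+1}\partial^{j+1}$, $F=\bigoplus_{i,j\ge 0}Ke_{ij}$, $E_{\mathbb N,i}=\bigoplus_{j} Ke_{ji}=Fe_{0i}$, $E_{i,\mathbb N}=\bigoplus_j Ke_{ij}=e_{i0}F$. Let $\mathbb I_1^0=\mathbb I_1\cap \mathrm{Aut}_K(K[x])$, let $(\mathbb I_1^0)^{-1}$ be the set of inverses of its elements, and let $\widetilde{\mathbb I}_1$ be the subalgebra of $\mathrm{End}_K(K[x])$ generated by $\mathbb I_1$ and $(\mathbb I_1^0)^{-1}$. For a vector space $V$, let $\mathcal C(V)$ be the ideal of $\mathrm{End}_K(V)$ of compact operators (linear maps with finite-dimensional image), and call a linear map Fredholm if its kernel and cokernel are finite-dimensional. Put $\mathcal C(\widetilde{\mathbb I}_1)=\widetilde{\mathbb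 I}_1\cap\mathcal C(K[x])$. For a subalgebra $A$ of $\mathrm{End}_K(V)$ all of whose noncompact elements are Fredholm, let $\overline A$ be its image in $\mathrm{End}_K(V)/\mathcal C(V)$ and let $\mathrm{frac}_V(A)$ be the intersection of all subalgebras of $\mathrm{End}_K(V)/\mathcal C(V)$ (if there are any) that consist of $0$ and of classes of Fredholm operators and contain $\overline A$ and the inverses of the nonzero elements of $\overline A$. Let $\mathrm{Frac}(A_1)$ be the skew field of fractions of $A_1$. "Proper ideal" means a two-sided ideal that is neither zero nor the whole ring. Then: 1. $(\mathbb I_1^0)^{-1}F=F$, but $F\subsetneq F(\mathbb I_1^0)^{-1}$. 2. $\mathbb I_1^0$ is a right but not a left Ore set of $\mathbb I_1$, and $\widetilde{\mathbb I}_1\simeq\mathbb I_1(\mathbb I_1^0)^{-1}$, i.e. the inclusion $\mathbb I_1\to\widetilde{\mathbb I}_1$ is the right localization of $\mathbb I_1$ at $\mathbb I_1^0$. 3. $F(\mathbb I_1^0)^{-1}$ is the only proper ideal of $\widetilde{\mathbb I}_1$, and $(F(\mathbb I_1^0)^{-1})^2=F(\mathbb I_1^0)^{-1}$. 4. $\widetilde{\mathbb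 I}_1/F(\mathbb I_1^0)^{-1}\simeq\mathrm{Frac}(A_1)$, canonically (compatibly with the maps from $A_1$). 5. $\mathcal C(\widetilde{\mathbb I}_1)=F(\mathbb I_1^0)^{-1}$. 6. Every noncompact element of $\widetilde{\mathbb I}_1$ is Fredholm on $K[x]$, $\mathrm{frac}_{K[x]}(\widetilde{\mathbb I}_1)$ exists, and $\mathrm{frac}_{K[x]}(\widetilde{\mathbb I}_1)\simeq\widetilde{\mathbb I}_1/\mathcal C(\widetilde{\mathbb I}_1)\simeq\mathrm{Frac}(A_1)$, canonically. 7. (a) Up to isomorphism there are exactly two simple left $\widetilde{\mathbb I}_1$-modules, $K[x]$ and $\mathrm{Frac}(A_1)=\widetilde{\mathbb I}_1/\mathcal C(\widetilde{\mathbb I}_1)$; the first is faithful and the second is not. (b) Up to isomorphism there are exactly two simple right $\widetilde{\mathbb I}_1$-modules, the localization $(\mathbb I_1/\int\mathbb I_1)(\mathbb I_1^0)^{-1}\simeq K[\partial](\mathbb I_1^0)^{-1}$ and $\mathrm{Frac}(A_1)=\widetilde{\mathbb I}_1/\mathcal C(\widetilde{\mathbb I}_1)$, where $K[\partial]$ is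 identified with $\mathbb I_1/\int\mathbb I_1$ by the bijection $q\mapsto q+\int\mathbb I_1$; the first is faithful and the second is not. 8. $F=\bigoplus_{i\in\mathbb N}E_{\mathbb N,i}$ is an infinite direct sum of nonzero left ideals $E_{\mathbb N,i}\simeq K[x]$ of $\widetilde{\mathbb I}_1$, so $\widetilde{\mathbb I}_1$ is not left Noetherian. $F(\mathbb I_1^0)^{-1}=(\bigoplus_{i\in\mathbb N}E_{i,\mathbb N})(\mathbb I_1^0)^{-1}=\bigoplus_{i\in\mathbb N}E_{i,\mathbb N}(\mathbb I_1^0)^{-1}$ is an infinite direct sum of nonzero right ideals $E_{i,\mathbb N}(\mathbb I_1^0)^{-1}$ of $\widetilde{\mathbb I}_1$, so $\widetilde{\mathbb I}_1$ is not right Noetherian. -/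

import Mathlib

universe u v w

open Polynomial Pointwise MulOpposite

noncomputable section

/-! ## Ore conditions, quotient rings, localization of right modules -/

/-- The right Ore condition for a multiplicatively closed set: `rS ∩ sR ≠ ∅`. -/
def IsRightOreSet {R : Type*} [Ring R] (S : Submonoid R) : Prop :=
  ∀ r : R, ∀ s ∈ S, ∃ t ∈ S, ∃ b : R, r * t = s * b

/-- The left Ore condition for a multiplicatively closed set: `Sr ∩ Rs ≠ ∅`. -/
def IsLeftOreSet {R : Type*} [Ring R] (S : Submonoid R) : Prop :=
  ∀ r : R, ∀ s ∈ S, ∃ t ∈ S, ∃ b : R, t * r = b * s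

/-- `φ : R → Q` is a right quotient ring `R S⁻¹` of `R` with respect to `S`. -/
structure IsRightQuotientRing {R Q : Type*} [Ring R] [Ring Q] (S : Submonoid R)
    (φ : R →+* Q) : Prop where
  isUnit : ∀ s ∈ S, IsUnit (φ s)
  exists_frac : ∀ q : Q, ∃ r : R, ∃ s ∈ S, ∃ u : Qˣ, (u : Q) = φ s ∧ q = φ r * (↑u⁻¹ : Q)
  ker : ∀ r : R, φ r = 0 ↔ ∃ s ∈ S, r * s = 0

/-- `φ : R → Q` is a left quotient ring `S⁻¹ R` of `R` with respect to `S`. -/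
structure IsLeftQuotientRing {R Q : Type*} [Ring R] [Ring Q] (S : Submonoid R)
    (φ : R →+* Q) : Prop where
  isUnit : ∀ s ∈ S, IsUnit (φ s)
  exists_frac : ∀ q : Q, ∃ r : R, ∃ s ∈ S, ∃ u : Qˣ, (u : Q) = φ s ∧ q = (↑u⁻¹ : Q) * φ r
  ker : ∀ r : R, φ r = 0 ↔ ∃ s ∈ S, s * r = 0

/-- `φ : R → Q` is the (left and right) quotient ring `Frac R` of `R`, i.e. its localization, on
both sides, at the set of all regular elements (elements that are neither left nor right zero
divisors). For an Ore domain this is the skew field of fractions. -/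
def IsFrac {R Q : Type*} [Ring R] [Ring Q] (φ : R →+* Q) : Prop :=
  IsLeftQuotientRing (nonZeroDivisors R) φ ∧ IsRightQuotientRing (nonZeroDivisors R) φ

/-- Let `j : R → Q` be a right quotient ring `R S⁻¹`. A map `φ : M → N` from a right `R`-module
to a right `Q`-module is a localization `M S⁻¹` of `M` at `S`: it is `R`-linear, every element of
`N` has the form `φ(m) s⁻¹`, and its kernel is the `S`-torsion of `M`. Right `R`-modules are
modules over `Rᵐᵒᵖ`. -/
structure IsRightModuleLocalization {R Q : Type*} [Ring R] [Ring Q] (S : Submonoid R)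
    (j : R →+* Q) {M N : Type*} [AddCommGroup M] [Module Rᵐᵒᵖ M]
    [AddCommGroup N] [Module Qᵐᵒᵖ N] (φ : M →+ N) : Prop where
  map_smul : ∀ (r : R) (m : M), φ (op r • m) = op (j r) • φ m
  exists_frac : ∀ n : N, ∃ m : M, ∃ s ∈ S, ∃ u : Qˣ, (u : Q) = j s ∧ n = op (↑u⁻¹ : Q) • φ m
  ker : ∀ m : M, φ m = 0 ↔ ∃ s ∈ S, op s • m = 0

/-! ## Compact and Fredholm operators -/

section Operators

variable (K : Type*) [Field K] (V : Type*) [AddCommGroup V] [Module K V]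

/-- The ideal of compact operators on `V`: the linear maps with finite dimensional image. -/
def compactIdeal : Ideal (Module.End K V) where
  carrier := {f | FiniteDimensional K (LinearMap.range f)}
  zero_mem' := by
    change FiniteDimensional K (LinearMap.range (0 : V →ₗ[K] V))
    rw [LinearMap.range_zero]
    infer_instance
  add_mem' := by
    intro f g hf hg
    have hf' : FiniteDimensional K (LinearMap.range f) := hf
    have hg' : FiniteDimensional K (LinearMap.range g) := hg
    refine Submodule.finiteDimensional_of_le (S₂ := LinearMap.range f ⊔ LinearMap.range g) ?_
    rintro _ ⟨v, rfl⟩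
    exact Submodule.add_mem_sup ⟨v, rfl⟩ ⟨v, rfl⟩
  smul_mem' := by
    intro g f hf
    have hf' : FiniteDimensional K (LinearMap.range f) := hf
    refine Submodule.finiteDimensional_of_le (S₂ := (LinearMap.range f).map g) ?_
    rintro _ ⟨v, rfl⟩
    exact ⟨f v, ⟨v, rfl⟩, rfl⟩

instance compactIdeal_isTwoSided : (compactIdeal K V).IsTwoSided where
  mul_mem_of_left := by
    intro f g hf
    have hf' : FiniteDimensional K (LinearMap.range f) := hf
    refine Submodule.finiteDimensional_of_le (S₂ := LinearMap.range f) ?_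
    rintro _ ⟨v, rfl⟩
    exact ⟨g v, rfl⟩

variable {K V}

/-- A Fredholm operator: finite dimensional kernel and cokernel. -/
def IsFredholmMap (f : Module.End K V) : Prop :=
  FiniteDimensional K (LinearMap.ker f) ∧ FiniteDimensional K (V ⧸ LinearMap.range f)

/-- The ideal `A ∩ 𝒞(V)` of compact operators of a subalgebra `A` of `End_K(V)`. -/
def compactIdealOf (A : Subalgebra K (Module.End K V)) : Ideal A :=
  (compactIdeal K V).comap A.val

instance compactIdealOf_isTwoSided (A : Subalgebra K (Module.End K V)) :
    (compactIdealOf A).IsTwoSided where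
  mul_mem_of_left := by
    intro a b ha
    exact Ideal.mul_mem_right (I := compactIdeal K V) (b : Module.End K V) ha

variable (K V) in
/-- The algebra of linear operators modulo compact operators. -/
abbrev OperatorsModCompact : Type _ := Module.End K V ⧸ compactIdeal K V

/-- The image `Ā` in `End_K(V)/𝒞(V)` of a subalgebra `A` of `End_K(V)`. -/
def imageModCompact (A : Subalgebra K (Module.End K V)) :
    Subalgebra K (OperatorsModCompact K V) :=
  A.map (Ideal.Quotient.mkₐ K (compactIdeal K V))

/-- The subalgebras of `End_K(V)/𝒞(V)` that consist of `0` and of classes of Fredholm operators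
and contain `Ā` together with the inverses of the nonzero elements of `Ā`. -/
def fracCandidates (A : Subalgebra K (Module.End K V)) :
    Set (Subalgebra K (OperatorsModCompact K V)) :=
  {B | (∀ b ∈ B, b = 0 ∨ ∃ f : Module.End K V,
          IsFredholmMap f ∧ Ideal.Quotient.mk (compactIdeal K V) f = b) ∧
       imageModCompact A ≤ B ∧
       ∀ u : (OperatorsModCompact K V)ˣ,
          (u : OperatorsModCompact K V) ∈ imageModCompact A →
            (↑u⁻¹ : OperatorsModCompact K V) ∈ B}

/-- `frac_V(A)`: the intersection of all the subalgebras above. It is meaningful for subalgebras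
`A` all of whose noncompact elements are Fredholm and for which such subalgebras exist. -/
def fracV (A : Subalgebra K (Module.End K V)) : Subalgebra K (OperatorsModCompact K V) :=
  sInf (fracCandidates A)

end Operators

/-! ## The Weyl algebra and polynomial integro-differential operators -/

namespace IntDiff

variable (K : Type*) [Field K]

/-- The polynomial algebra `K[x]`, regarded only as a `K`-vector space. -/
def Pol : Type _ := K[X]

instance : AddCommGroup (Pol K) := inferInstanceAs (AddCommGroup K[X])

instance : Module K (Pol K) := inferInstanceAs (Module K K[X])

/-- Multiplication by `x` on `K[x]`. -/
def opX : Module.End K (Pol K) :=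
  (LinearMap.mulLeft K (X : K[X]) : K[X] →ₗ[K] K[X])

/-- The derivation `∂ = d/dx` on `K[x]`. -/
def opD : Module.End K (Pol K) := (Polynomial.derivative : K[X] →ₗ[K] K[X])

/-- Integration of polynomials: `x ^ n ↦ x ^ (n + 1) / (n + 1)`. -/
def polyInt : K[X] →ₗ[K] K[X] :=
  Polynomial.lsum fun n : ℕ => ((n : K) + 1)⁻¹ • Polynomial.monomial (n + 1)

/-- Integration as an operator on `K[x]`. -/
def opInt : Module.End K (Pol K) := polyInt K

/-- The first Weyl algebra `A₁`. -/
def A1 : Subalgebra K (Module.End K (Pol K)) := Algebra.adjoin K {opX K, opD K}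

/-- The algebra `I₁` of polynomial integro-differential operators. -/
def I1 : Subalgebra K (Module.End K (Pol K)) := Algebra.adjoin K {opX K, opD K, opInt K}

/-- The multiplicative monoid `I₁⁰ = I₁ ∩ Aut_K(K[x])`. -/
def I10 : Submonoid (I1 K) := (IsUnit.submonoid (Module.End K (Pol K))).comap (I1 K).val

/-- The set `(I₁⁰)⁻¹` of inverses in `Aut_K(K[x])` of the elements of `I₁⁰`. -/
def I10inv : Set (Module.End K (Pol K)) :=
  {t | ∃ u : (Module.End K (Pol K))ˣ, (u : Module.End K (Pol K)) ∈ I1 K ∧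
    t = (↑u⁻¹ : Module.End K (Pol K))}

/-- The algebra `Ĩ₁` generated by `I₁` and `(I₁⁰)⁻¹`. -/
def tI1 : Subalgebra K (Module.End K (Pol K)) :=
  Algebra.adjoin K ((I1 K : Set (Module.End K (Pol K))) ∪ I10inv K)

lemma A1_le_I1 : A1 K ≤ I1 K :=
  Algebra.adjoin_mono (by
    intro a ha
    simp only [Set.mem_insert_iff, Set.mem_singleton_iff] at ha ⊢
    tauto)

lemma I1_le_tI1 : I1 K ≤ tI1 K := fun _ ha => Algebra.subset_adjoin (Or.inl ha)

/-- The inclusion `I₁ → Ĩ₁`. -/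
def inclI1 : I1 K →ₐ[K] tI1 K := Subalgebra.inclusion (I1_le_tI1 K)

/-- The inclusion `A₁ → Ĩ₁`. -/
def inclA1 : A1 K →ₐ[K] tI1 K := Subalgebra.inclusion ((A1_le_I1 K).trans (I1_le_tI1 K))

/-- `∂` as an element of `I₁`. -/
def dI1 : I1 K := ⟨opD K, Algebra.subset_adjoin (by simp)⟩

/-- Integration as an element of `I₁`. -/
def intI1 : I1 K := ⟨opInt K, Algebra.subset_adjoin (by simp)⟩

/-- The right ideal `∫ I₁` of `I₁`. -/
def intIdeal : Submodule (I1 K)ᵐᵒᵖ (I1 K) := Submodule.span (I1 K)ᵐᵒᵖ {intI1 K}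

/-- The matrix units `e_{ij} = ∫ⁱ∂ʲ - ∫ⁱ⁺¹∂ʲ⁺¹`. -/
def e (i j : ℕ) : Module.End K (Pol K) :=
  opInt K ^ i * opD K ^ j - opInt K ^ (i + 1) * opD K ^ (j + 1)

/-- `F`, the span of the matrix units. -/
def F : Submodule K (Module.End K (Pol K)) :=
  Submodule.span K (Set.range fun p : ℕ × ℕ => e K p.1 p.2)

/-- `E_{ℕ,i}`, the span of `e_{ji}`, `j ∈ ℕ`. -/
def Ecol (i : ℕ) : Submodule K (Module.End K (Pol K)) :=
  Submodule.span K (Set.range fun j : ℕ => e K j i)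

/-- `E_{i,ℕ}`, the span of `e_{ij}`, `j ∈ ℕ`. -/
def Erow (i : ℕ) : Submodule K (Module.End K (Pol K)) :=
  Submodule.span K (Set.range fun j : ℕ => e K i j)

/-- The set `F (I₁⁰)⁻¹` of all products `f s⁻¹`. -/
def FS : Set (Module.End K (Pol K)) := (F K : Set (Module.End K (Pol K))) * I10inv K

/-- The ideal of compact operators of `Ĩ₁`, `Ĩ₁ ∩ 𝒞(K[x])`. -/
abbrev C : Ideal (tI1 K) := compactIdealOf (tI1 K)

/-- The same ideal, as a right ideal. -/
def Cright : Submodule (tI1 K)ᵐᵒᵖ (tI1 K) where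
  carrier := (C K : Set (tI1 K))
  zero_mem' := (C K).zero_mem
  add_mem' := (C K).add_mem
  smul_mem' := fun r _ ha => Ideal.mul_mem_right (I := C K) r.unop ha

/-- The embedding of `Ĩ₁` in `End_K(K[x])`, on subsets. -/
def asOps (T : Set (tI1 K)) : Set (Module.End K (Pol K)) :=
  (fun a : tI1 K => (a : Module.End K (Pol K))) '' T

end IntDiff

end

noncomputable section

namespace IntDiff

variable {K : Type u} [Field K] [CharZero K]

set_option linter.unusedSectionVars false

/-! ### The basis of divided powers and the matrix units -/

/-! Write v_n = x^n/n!. In this basis ∂ and ∫ are the shifts down and up, x is a weighted shift up,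
and the e_ij are matrix units. So F is the set of operators that kill v_n for all large n
(`mem_F_iff`). It is a left ideal of the whole endomorphism ring, but it is stable under right
multiplication only by special operators, such as those of I₁, which move indices by a bounded
amount. This asymmetry is behind the failure of the left Ore condition: e_00 (1 - ∂)⁻¹ sends every
v_n to v_0, hence lies outside F.

The engine is `exists_unit_of_notMem_F`: an element a of I₁ outside F becomes an automorphism after
right multiplication by some c in I₁ and a correction from F. By `exists_A1_add_F`, a∂^k agrees
modulo F with some nonzero w in A₁. For large n, w acts on v_n as a band operator whose coefficients
are polynomials in n, and in characteristic zero the leading one vanishes at only finitely many n. A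
power of ∂ or ∫ then makes w preserve degrees far out, and F repairs the finitely many remaining
columns. Hence the compact elements of I₁ are those of F, and all others are invertible modulo
compacts.

A dimension count yields the Ore conditions in A₁. The right one is transported to I₁⁰
(`I1_rightOre`), so every element of Ĩ₁ is some r u⁻¹ (`mem_tI1_iff`). It is compact exactly when r
is in F, and otherwise it has an inverse modulo compacts that comes from Ĩ₁ (`exists_inv_modC`). So
Ĩ₁/𝒞(Ĩ₁) is a skew field; comparing r∂^k ≡ w with u∂^k ≡ v exhibits its elements as fractions w v⁻¹
over A₁.

Matrix units settle the rest. Every nonzero two-sided ideal contains all of them. A simple module is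
either killed by all of them, hence is the quotient skew field, or receives a nonzero map from K[x]
(on the left) or from e_00 Ĩ₁ (on the right). -/

variable (K) in
/-- The basis `xⁿ / n!` of `K[x]`. -/
def divPowPoly : Module.Basis ℕ K K[X] :=
  (Polynomial.basisMonomials K).isUnitSMul (w := fun n => ((n.factorial : K))⁻¹)
    fun n => (inv_ne_zero (Nat.cast_ne_zero.2 n.factorial_ne_zero)).isUnit

lemma divPowPoly_apply (n : ℕ) : divPowPoly K n = monomial n ((n.factorial : K))⁻¹ := by
  rw [divPowPoly, Module.Basis.isUnitSMul_apply, Polynomial.coe_basisMonomials,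
    Polynomial.smul_monomial, smul_eq_mul, mul_one]

lemma derivative_divPowPoly_succ (n : ℕ) :
    derivative (divPowPoly K (n + 1)) = divPowPoly K n := by
  have h : ((n : K) + 1) ≠ 0 := by exact_mod_cast n.succ_ne_zero
  have h' : ((n.factorial : K)) ≠ 0 := by exact_mod_cast n.factorial_ne_zero
  rw [divPowPoly_apply, divPowPoly_apply, Polynomial.derivative_monomial, Nat.factorial_succ]
  push_cast
  congr 1
  field_simp

lemma derivative_divPowPoly_zero : derivative (divPowPoly K 0) = 0 := by
  rw [divPowPoly_apply, Polynomial.derivative_monomial]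
  simp

lemma polyInt_divPowPoly (n : ℕ) : polyInt K (divPowPoly K n) = divPowPoly K (n + 1) := by
  rw [divPowPoly_apply, divPowPoly_apply, polyInt, Polynomial.lsum_apply,
    Polynomial.sum_monomial_index _ _ (by simp), LinearMap.smul_apply, Polynomial.smul_monomial,
    smul_eq_mul, Nat.factorial_succ]
  push_cast
  rw [mul_inv]

lemma X_mul_divPowPoly (n : ℕ) :
    X * divPowPoly K n = ((n : K) + 1) • divPowPoly K (n + 1) := by
  have h : ((n : K) + 1) ≠ 0 := by exact_mod_cast n.succ_ne_zero
  have h' : ((n.factorial : K)) ≠ 0 := by exact_mod_cast n.factorial_ne_zero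
  rw [divPowPoly_apply, divPowPoly_apply, Polynomial.X_mul_monomial, Polynomial.smul_monomial,
    Nat.factorial_succ, smul_eq_mul]
  push_cast
  congr 1
  field_simp

variable (K) in
/-- The basis `xⁿ / n!` of `Pol K`. -/
def divPow : Module.Basis ℕ K (Pol K) := divPowPoly K

lemma opD_succ (n : ℕ) : opD K (divPow K (n + 1)) = divPow K n := derivative_divPowPoly_succ n

lemma opD_zero : opD K (divPow K 0) = 0 := derivative_divPowPoly_zero

lemma opInt_divPow (n : ℕ) : opInt K (divPow K n) = divPow K (n + 1) := polyInt_divPowPoly n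

lemma opX_divPow (n : ℕ) : opX K (divPow K n) = ((n : K) + 1) • divPow K (n + 1) :=
  X_mul_divPowPoly n

lemma opD_mul_opInt : opD K * opInt K = 1 :=
  (divPow K).ext fun n => by
    rw [Module.End.mul_apply, opInt_divPow, opD_succ, Module.End.one_apply]

lemma opD_pow_mul_opInt_pow (n : ℕ) : opD K ^ n * opInt K ^ n = 1 := by
  induction n with
  | zero => simp
  | succ n ih =>
    rw [pow_succ, pow_succ', mul_assoc, ← mul_assoc (opD K), opD_mul_opInt, one_mul, ih]

lemma opInt_pow_divPow (i n : ℕ) : (opInt K ^ i) (divPow K n) = divPow K (n + i) := by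
  induction i with
  | zero => simp
  | succ i ih => rw [pow_succ', Module.End.mul_apply, ih, opInt_divPow, add_assoc]

lemma opD_pow_add (j n : ℕ) : (opD K ^ j) (divPow K (n + j)) = divPow K n := by
  rw [← opInt_pow_divPow, ← Module.End.mul_apply, opD_pow_mul_opInt_pow, Module.End.one_apply]

lemma opD_pow_of_lt {j n : ℕ} (h : n < j) : (opD K ^ j) (divPow K n) = 0 := by
  obtain ⟨k, rfl⟩ := Nat.exists_eq_add_of_lt h
  have h0 := opD_pow_add (K := K) n 0
  rw [zero_add] at h0
  rw [show n + k + 1 = k + 1 + n by omega, pow_add, Module.End.mul_apply, h0, pow_succ,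
    Module.End.mul_apply, opD_zero, map_zero]

/-- The operator that maps `xⁿ / n!` to `v` and the other divided powers to `0`. -/
def col (n : ℕ) (v : Pol K) : Module.End K (Pol K) := ((divPow K).coord n).smulRight v

lemma col_apply (n : ℕ) (v w : Pol K) : col n v w = (divPow K).repr w n • v := rfl

lemma col_divPow (n m : ℕ) (v : Pol K) : col n v (divPow K m) = if m = n then v else 0 := by
  rw [col_apply, Module.Basis.repr_self, Finsupp.single_apply]
  split_ifs <;> simp

lemma mul_col (a : Module.End K (Pol K)) (n : ℕ) (v : Pol K) : a * col n v = col n (a v) :=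
  LinearMap.ext fun w => by rw [Module.End.mul_apply, col_apply, col_apply, map_smul]

/-- On v_n both terms vanish for n < j, and both give v_{n-j+i} for n > j and cancel; at n = j only
the first survives. -/
lemma e_eq_col (i j : ℕ) : e K i j = col j (divPow K i) := by
  refine (divPow K).ext fun n => ?_
  rw [e, LinearMap.sub_apply, Module.End.mul_apply, Module.End.mul_apply, col_divPow]
  rcases lt_trichotomy n j with h | rfl | h
  · rw [opD_pow_of_lt h, opD_pow_of_lt (Nat.lt_succ_of_lt h), if_neg h.ne]
    simp
  · have h0 := opD_pow_add (K := K) n 0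
    rw [zero_add] at h0
    rw [h0, opD_pow_of_lt (Nat.lt_succ_self n), opInt_pow_divPow, if_pos rfl]
    simp
  · obtain ⟨k, rfl⟩ := Nat.exists_eq_add_of_lt h
    have h1 := opD_pow_add (K := K) j (k + 1)
    have h2 := opD_pow_add (K := K) (j + 1) k
    rw [show j + k + 1 = k + 1 + j by omega, h1, show k + 1 + j = k + (j + 1) by omega, h2,
      opInt_pow_divPow, opInt_pow_divPow, if_neg (by omega), show k + (i + 1) = k + 1 + i by omega,
      sub_self]

lemma e_divPow (i j n : ℕ) : e K i j (divPow K n) = if n = j then divPow K i else 0 := by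
  rw [e_eq_col, col_divPow]

lemma e_divPow_self (i j : ℕ) : e K i j (divPow K j) = divPow K i := by
  rw [e_divPow, if_pos rfl]

lemma mul_e (a : Module.End K (Pol K)) (i j : ℕ) : a * e K i j = col j (a (divPow K i)) := by
  rw [e_eq_col, mul_col]

lemma e_mul_e (i j k l : ℕ) : e K i j * e K k l = if j = k then e K i l else 0 := by
  rw [mul_e, e_divPow]
  rcases eq_or_ne k j with rfl | h
  · rw [if_pos rfl, if_pos rfl, e_eq_col]
  · rw [if_neg h, if_neg h.symm, col, LinearMap.smulRight_zero]

lemma e_mul_e_self (i j l : ℕ) : e K i j * e K j l = e K i l := by rw [e_mul_e, if_pos rfl]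

lemma e_mul_opInt (i : ℕ) : e K i 0 * opInt K = 0 :=
  (divPow K).ext fun n => by
    rw [Module.End.mul_apply, opInt_divPow, e_divPow, if_neg n.succ_ne_zero, LinearMap.zero_apply]

lemma opInt_mul_opD : opInt K * opD K = 1 - e K 0 0 := by
  rw [e, pow_zero, pow_zero, zero_add, pow_one, pow_one, mul_one, sub_sub_cancel]

lemma e_ne_zero (i j : ℕ) : e K i j ≠ 0 := fun h => by
  have := e_divPow_self (K := K) i j
  rw [h] at this
  exact (divPow K).ne_zero i this.symm

lemma opInt_mem : opInt K ∈ I1 K := Algebra.subset_adjoin (by simp)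

lemma opD_mem : opD K ∈ I1 K := Algebra.subset_adjoin (by simp)

lemma opX_mem : opX K ∈ I1 K := Algebra.subset_adjoin (by simp)

lemma e_mem_I1 (i j : ℕ) : e K i j ∈ I1 K :=
  sub_mem (mul_mem (pow_mem opInt_mem _) (pow_mem opD_mem _))
    (mul_mem (pow_mem opInt_mem _) (pow_mem opD_mem _))

/-! ### The ideal `F` of finitary matrices -/

lemma col_mem_Ecol (n : ℕ) (v : Pol K) : col n v ∈ Ecol K n := by
  have hv : v ∈ Submodule.span K (Set.range (divPow K)) := (divPow K).mem_span v
  induction hv using Submodule.span_induction with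
  | mem v hv => obtain ⟨i, rfl⟩ := hv; exact Submodule.subset_span ⟨i, e_eq_col i n⟩
  | zero => rw [col, LinearMap.smulRight_zero]; exact zero_mem _
  | add v w _ _ hv hw =>
    have : col n (v + w) = col n v + col n w :=
      LinearMap.ext fun _ => by simp [col_apply]
    rw [this]; exact add_mem hv hw
  | smul c v _ hv =>
    have : col n (c • v) = c • col n v :=
      LinearMap.ext fun u => by simp [col_apply, smul_comm _ c]
    rw [this]; exact Submodule.smul_mem _ _ hv

lemma e_mem_F (i j : ℕ) : e K i j ∈ F K := Submodule.subset_span ⟨(i, j), rfl⟩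

lemma Ecol_le_F (n : ℕ) : Ecol K n ≤ F K :=
  Submodule.span_le.2 (by rintro _ ⟨j, rfl⟩; exact e_mem_F j n)

lemma Erow_le_F (n : ℕ) : Erow K n ≤ F K :=
  Submodule.span_le.2 (by rintro _ ⟨j, rfl⟩; exact e_mem_F n j)

lemma F_le_I1 {f : Module.End K (Pol K)} (hf : f ∈ F K) : f ∈ I1 K := by
  have : F K ≤ Subalgebra.toSubmodule (I1 K) :=
    Submodule.span_le.2 (by rintro _ ⟨p, rfl⟩; exact e_mem_I1 _ _)
  exact this hf

/-- An operator with finitely many nonzero columns is the sum of its columns, and each column lies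
in some E_{ℕ,n}. This is the working description of F. -/
lemma mem_F_iff {f : Module.End K (Pol K)} :
    f ∈ F K ↔ ∃ N, ∀ n ≥ N, f (divPow K n) = 0 := by
  constructor
  · intro hf
    induction hf using Submodule.span_induction with
    | mem f hf =>
      obtain ⟨p, rfl⟩ := hf
      exact ⟨p.2 + 1, fun n hn => by rw [e_divPow, if_neg (by omega)]⟩
    | zero => exact ⟨0, fun _ _ => rfl⟩
    | add f g _ _ hf hg =>
      obtain ⟨N, hN⟩ := hf
      obtain ⟨M, hM⟩ := hg
      exact ⟨N + M, fun n hn => by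
        rw [LinearMap.add_apply, hN n (by omega), hM n (by omega), add_zero]⟩
    | smul c f _ hf =>
      obtain ⟨N, hN⟩ := hf
      exact ⟨N, fun n hn => by rw [LinearMap.smul_apply, hN n hn, smul_zero]⟩
  · rintro ⟨N, hN⟩
    have : f = ∑ n ∈ Finset.range N, col n (f (divPow K n)) := by
      refine (divPow K).ext fun m => ?_
      rw [LinearMap.sum_apply]
      simp_rw [col_divPow]
      rw [Finset.sum_ite_eq]
      split_ifs with h
      · rfl
      · exact hN m (by simpa using h)
    rw [this]
    exact sum_mem fun n _ => Ecol_le_F n (col_mem_Ecol n _)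

/-- Zero columns stay zero under any left factor; no condition on the factor is needed, so inverses
of elements of I₁⁰ are allowed. -/
lemma mul_mem_F (a : Module.End K (Pol K)) {f : Module.End K (Pol K)} (hf : f ∈ F K) :
    a * f ∈ F K := by
  obtain ⟨N, hN⟩ := mem_F_iff.1 hf
  exact mem_F_iff.2 ⟨N, fun n hn => by rw [Module.End.mul_apply, hN n hn, map_zero]⟩

/-- Each generator sends v_n to a multiple of a neighbour, so the cutoff moves by at most one. The
operator in F is quantified inside the induction so that a product can be absorbed factor by factor.
-/
lemma F_mul_mem {a : Module.End K (Pol K)} (ha : a ∈ I1 K) :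
    ∀ {f : Module.End K (Pol K)}, f ∈ F K → f * a ∈ F K := by
  induction ha using Algebra.adjoin_induction with
  | mem a ha =>
    intro f hf
    obtain ⟨N, hN⟩ := mem_F_iff.1 hf
    refine mem_F_iff.2 ⟨N + 1, fun n hn => ?_⟩
    obtain ⟨n, rfl⟩ : ∃ k, n = k + 1 := ⟨n - 1, by omega⟩
    rw [Module.End.mul_apply]
    rcases ha with rfl | rfl | rfl
    · rw [opX_divPow, map_smul, hN _ (by omega), smul_zero]
    · rw [opD_succ, hN _ (by omega)]
    · rw [opInt_divPow, hN _ (by omega)]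
  | algebraMap c =>
    intro f hf
    rw [← Algebra.commutes, ← Algebra.smul_def]
    exact Submodule.smul_mem _ _ hf
  | add a b _ _ ha hb => intro f hf; rw [mul_add]; exact add_mem (ha hf) (hb hf)
  | mul a b _ _ ha hb => intro f hf; rw [← mul_assoc]; exact hb (ha hf)

lemma F_le_compact {f : Module.End K (Pol K)} (hf : f ∈ F K) : f ∈ compactIdeal K (Pol K) := by
  induction hf using Submodule.span_induction with
  | mem f hf =>
    obtain ⟨p, rfl⟩ := hf
    change FiniteDimensional K (LinearMap.range (e K p.1 p.2))
    refine Submodule.finiteDimensional_of_le (S₂ := K ∙ divPow K p.1) ?_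
    rintro _ ⟨v, rfl⟩
    rw [e_eq_col]
    exact Submodule.smul_mem _ _ (Submodule.mem_span_singleton_self _)
  | zero => exact zero_mem _
  | add f g _ _ hf hg => exact add_mem hf hg
  | smul c f _ hf =>
    rw [Algebra.smul_def]
    exact Ideal.mul_mem_left _ _ hf

lemma one_notMem_compact : (1 : Module.End K (Pol K)) ∉ compactIdeal K (Pol K) := by
  intro h
  have h : FiniteDimensional K (LinearMap.range (1 : Module.End K (Pol K))) := h
  rw [Module.End.one_eq_id, LinearMap.range_id] at h
  have : FiniteDimensional K (Pol K) := Module.Finite.equiv Submodule.topEquiv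
  have := Module.Finite.finite_basis (divPow K)
  exact Infinite.not_finite this

lemma mem_Ecol_iff {i : ℕ} {a : Module.End K (Pol K)} :
    a ∈ Ecol K i ↔ a = col i (a (divPow K i)) := by
  constructor
  · intro h
    rw [← mul_e]
    induction h using Submodule.span_induction with
    | mem f hf => obtain ⟨j, rfl⟩ := hf; exact (e_mul_e_self _ _ _).symm
    | zero => simp
    | add f g _ _ hf hg => rw [add_mul, ← hf, ← hg]
    | smul c f _ hf => rw [smul_mul_assoc, ← hf]
  · intro h
    rw [h]
    exact col_mem_Ecol _ _

lemma e_mul_mem_Erow (i k : ℕ) {f : Module.End K (Pol K)} (hf : f ∈ F K) :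
    e K i k * f ∈ Erow K i := by
  induction hf using Submodule.span_induction with
  | mem f hf =>
    obtain ⟨p, rfl⟩ := hf
    simp only [e_mul_e]
    split_ifs
    · exact Submodule.subset_span ⟨_, rfl⟩
    · exact zero_mem _
  | zero => simp
  | add f g _ _ hf hg => rw [mul_add]; exact add_mem hf hg
  | smul c f _ hf => rw [mul_smul_comm]; exact Submodule.smul_mem _ _ hf

lemma e_mul_of_mem_Erow {i : ℕ} {f : Module.End K (Pol K)} (hf : f ∈ Erow K i) :
    e K i i * f = f := by
  induction hf using Submodule.span_induction with
  | mem f hf => obtain ⟨j, rfl⟩ := hf; exact e_mul_e_self _ _ _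
  | zero => simp
  | add f g _ _ hf hg => rw [mul_add, hf, hg]
  | smul c f _ hf => rw [mul_smul_comm, hf]

/-! ### The Weyl algebra: the basis `xⁱ ∂ʲ` -/

lemma opD_mul_opX : opD K * opX K = opX K * opD K + 1 :=
  (divPow K).ext fun n => by
    rw [Module.End.mul_apply, opX_divPow, map_smul, opD_succ, LinearMap.add_apply,
      Module.End.mul_apply, Module.End.one_apply]
    cases n with
    | zero =>
      rw [opD_zero, LinearMap.map_zero, Nat.cast_zero, zero_add, zero_add, one_smul]
    | succ n => rw [opD_succ, opX_divPow, add_smul, one_smul]; push_cast; rfl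

lemma opD_mul_opX_pow (i : ℕ) :
    opD K * opX K ^ (i + 1) = opX K ^ (i + 1) * opD K + ((i : K) + 1) • opX K ^ i := by
  induction i with
  | zero => simpa using opD_mul_opX
  | succ i ih =>
    rw [pow_succ, ← mul_assoc, ih, add_mul, mul_assoc, opD_mul_opX, mul_add, smul_mul_assoc,
      ← pow_succ, mul_one, ← mul_assoc, ← pow_succ, add_assoc]
    congr 1
    push_cast
    module

lemma opX_mem_A1 : opX K ∈ A1 K := Algebra.subset_adjoin (by simp)

lemma opD_mem_A1 : opD K ∈ A1 K := Algebra.subset_adjoin (by simp)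

variable (K) in
/-- The operators `xⁱ ∂ʲ`. -/
def pbw (p : ℕ × ℕ) : Module.End K (Pol K) := opX K ^ p.1 * opD K ^ p.2

variable (K) in
/-- The span of the operators `xⁱ ∂ʲ` with `i ≤ m` and `j ≤ n`. -/
def pbwSpan (m n : ℕ) : Submodule K (Module.End K (Pol K)) :=
  Submodule.span K (pbw K '' ((Finset.range (m + 1) ×ˢ Finset.range (n + 1) : Finset (ℕ × ℕ)) :
    Set (ℕ × ℕ)))

lemma pbw_mem_pbwSpan {i j m n : ℕ} (hi : i ≤ m) (hj : j ≤ n) :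
    opX K ^ i * opD K ^ j ∈ pbwSpan K m n :=
  Submodule.subset_span ⟨(i, j), by simp; omega, rfl⟩

lemma pbwSpan_induction {m n : ℕ} {S : Submodule K (Module.End K (Pol K))}
    (h : ∀ i ≤ m, ∀ j ≤ n, opX K ^ i * opD K ^ j ∈ S) : pbwSpan K m n ≤ S := by
  refine Submodule.span_le.2 ?_
  rintro _ ⟨p, hp, rfl⟩
  simp only [Finset.coe_product, Finset.coe_range, Set.mem_prod, Set.mem_Iio] at hp
  exact h _ (by omega) _ (by omega)

lemma pbwSpan_mono {m n m' n' : ℕ} (hm : m ≤ m') (hn : n ≤ n') :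
    pbwSpan K m n ≤ pbwSpan K m' n' :=
  pbwSpan_induction fun _ hi _ hj => pbw_mem_pbwSpan (hi.trans hm) (hj.trans hn)

lemma opX_mul_pbwSpan {m n : ℕ} {a : Module.End K (Pol K)} (ha : a ∈ pbwSpan K m n) :
    opX K * a ∈ pbwSpan K (m + 1) n := by
  have : pbwSpan K m n ≤ (pbwSpan K (m + 1) n).comap (LinearMap.mulLeft K (opX K)) :=
    pbwSpan_induction fun i hi j hj => by
      rw [Submodule.mem_comap, LinearMap.mulLeft_apply, ← mul_assoc, ← pow_succ']
      exact pbw_mem_pbwSpan (by omega) hj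
  exact this ha

lemma opD_mul_pbwSpan {m n : ℕ} {a : Module.End K (Pol K)} (ha : a ∈ pbwSpan K m n) :
    opD K * a ∈ pbwSpan K m (n + 1) := by
  have : pbwSpan K m n ≤ (pbwSpan K m (n + 1)).comap (LinearMap.mulLeft K (opD K)) :=
    pbwSpan_induction fun i hi j hj => by
      rw [Submodule.mem_comap, LinearMap.mulLeft_apply, ← mul_assoc]
      cases i with
      | zero =>
        rw [pow_zero, mul_one, ← pow_succ', ← one_mul (opD K ^ (j + 1)), ← pow_zero (opX K)]
        exact pbw_mem_pbwSpan hi (by omega)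
      | succ i =>
        rw [opD_mul_opX_pow, add_mul, mul_assoc, ← pow_succ', smul_mul_assoc]
        exact add_mem (pbw_mem_pbwSpan hi (by omega))
          (Submodule.smul_mem _ _ (pbw_mem_pbwSpan (by omega) (by omega)))
  exact this ha

/-- Moving ∂ past x^i only produces terms with a smaller power of x, so the rectangles of exponents
form a filtration; the dimension count for the Ore conditions rests on it. -/
lemma mul_mem_pbwSpan {m n m' n' : ℕ} {a b : Module.End K (Pol K)} (ha : a ∈ pbwSpan K m n)
    (hb : b ∈ pbwSpan K m' n') : a * b ∈ pbwSpan K (m' + m) (n' + n) := by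
  have : pbwSpan K m n ≤ (pbwSpan K (m' + m) (n' + n)).comap (LinearMap.mulRight K b) :=
    pbwSpan_induction fun i hi j hj => by
      rw [Submodule.mem_comap, LinearMap.mulRight_apply]
      have hD : ∀ j, opD K ^ j * b ∈ pbwSpan K m' (n' + j) := fun j => by
        induction j with
        | zero => simpa using hb
        | succ j ih => rw [pow_succ', mul_assoc]; exact opD_mul_pbwSpan ih
      have hX : ∀ i, opX K ^ i * (opD K ^ j * b) ∈ pbwSpan K (m' + i) (n' + j) := fun i => by
        induction i with
        | zero => simpa using hD j
        | succ j ih => rw [pow_succ', mul_assoc]; exact opX_mul_pbwSpan ih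
      rw [mul_assoc]
      exact pbwSpan_mono (by omega) (by omega) (hX i)
  exact this ha

lemma pbwSpan_le_A1 (m n : ℕ) {a : Module.End K (Pol K)} (ha : a ∈ pbwSpan K m n) : a ∈ A1 K := by
  have : pbwSpan K m n ≤ Subalgebra.toSubmodule (A1 K) := pbwSpan_induction fun i _ j _ =>
    (A1 K).mul_mem (pow_mem opX_mem_A1 i) (pow_mem opD_mem_A1 j)
  exact this ha

lemma exists_mem_pbwSpan {a : Module.End K (Pol K)} (ha : a ∈ A1 K) : ∃ n, a ∈ pbwSpan K n n := by
  induction ha using Algebra.adjoin_induction with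
  | mem a ha =>
    refine ⟨1, ?_⟩
    rcases ha with rfl | rfl
    · simpa using pbw_mem_pbwSpan (K := K) (i := 1) (j := 0) (m := 1) (n := 1)
    · simpa using pbw_mem_pbwSpan (K := K) (i := 0) (j := 1) (m := 1) (n := 1)
  | algebraMap c =>
    refine ⟨0, ?_⟩
    rw [Algebra.algebraMap_eq_smul_one]
    exact Submodule.smul_mem _ _ (by simpa using pbw_mem_pbwSpan (K := K) (le_refl 0) (le_refl 0))
  | add a b _ _ ha hb =>
    obtain ⟨n, hn⟩ := ha
    obtain ⟨m, hm⟩ := hb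
    exact ⟨n + m, add_mem (pbwSpan_mono (by omega) (by omega) hn)
      (pbwSpan_mono (by omega) (by omega) hm)⟩
  | mul a b _ _ ha hb =>
    obtain ⟨n, hn⟩ := ha
    obtain ⟨m, hm⟩ := hb
    exact ⟨m + n, mul_mem_pbwSpan hn hm⟩

lemma exists_opX_pow_divPow (i : ℕ) :
    ∃ p : K[X], ∀ n : ℕ, (opX K ^ i) (divPow K n) = p.eval (n : K) • divPow K (n + i) := by
  induction i with
  | zero => exact ⟨1, fun n => by simp⟩
  | succ i ih =>
    obtain ⟨p, hp⟩ := ih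
    refine ⟨p * (X + Polynomial.C ((i : K) + 1)), fun n => ?_⟩
    rw [pow_succ', Module.End.mul_apply, hp, map_smul, opX_divPow, smul_smul, add_assoc n i 1]
    simp [add_assoc]

lemma opX_pow_divPow_zero (i : ℕ) :
    (opX K ^ i) (divPow K 0) = (i.factorial : K) • divPow K i := by
  induction i with
  | zero => simp
  | succ i ih =>
    rw [pow_succ', Module.End.mul_apply, ih, map_smul, opX_divPow, smul_smul, Nat.factorial_succ]
    push_cast
    rw [mul_comm]

/-- Evaluate a relation at v_j, by strong induction on j: larger powers of ∂ kill v_j, smaller ones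
already have zero coefficients, and x^i ∂^j v_j is a nonzero multiple of v_i. -/
lemma linearIndependent_pbw : LinearIndependent K (pbw K) := by
  rw [linearIndependent_iff]
  intro c hc
  have key : ∀ j i, c (i, j) = 0 := by
    intro j
    induction j using Nat.strong_induction_on with
    | _ j ih =>
      intro i
      have h : (divPow K).repr
          ((Finsupp.linearCombination K (pbw K) c) (divPow K j)) i = 0 := by
        rw [hc, LinearMap.zero_apply, map_zero, Finsupp.zero_apply]
      rw [Finsupp.linearCombination_apply, Finsupp.sum, LinearMap.sum_apply, map_sum,
        Finsupp.finsetSum_apply, Finset.sum_eq_single (i, j)] at h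
      · have h0 := opD_pow_add (K := K) j 0
        rw [zero_add] at h0
        rw [LinearMap.smul_apply, pbw, Module.End.mul_apply, h0, opX_pow_divPow_zero, smul_smul,
          map_smul, Module.Basis.repr_self, Finsupp.smul_apply, Finsupp.single_eq_same,
          smul_eq_mul, mul_one] at h
        exact (mul_eq_zero.1 h).resolve_right (by exact_mod_cast i.factorial_ne_zero)
      · rintro ⟨i', j'⟩ - hne
        rcases lt_trichotomy j' j with hj | rfl | hj
        · rw [ih j' hj i', zero_smul, LinearMap.zero_apply, map_zero, Finsupp.zero_apply]
        · have h0 := opD_pow_add (K := K) j' 0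
          rw [zero_add] at h0
          rw [LinearMap.smul_apply, pbw, Module.End.mul_apply, h0, opX_pow_divPow_zero, smul_smul,
            map_smul, Module.Basis.repr_self, Finsupp.smul_apply, Finsupp.single_apply,
            if_neg (by rintro rfl; exact hne rfl), smul_zero]
        · rw [LinearMap.smul_apply, pbw, Module.End.mul_apply, opD_pow_of_lt hj, map_zero,
            smul_zero, map_zero, Finsupp.zero_apply]
      · intro h'
        rw [Finsupp.notMem_support_iff.1 h', zero_smul, LinearMap.zero_apply, map_zero,
          Finsupp.zero_apply]
  ext ⟨i, j⟩
  exact key j i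

/-! ### The Weyl algebra meets `F` trivially -/

variable (K) in
/-- The inner derivation `a ↦ a x - x a`. -/
def adX : Module.End K (Module.End K (Pol K)) :=
  LinearMap.mulRight K (opX K) - LinearMap.mulLeft K (opX K)

lemma adX_apply (a : Module.End K (Pol K)) : adX K a = a * opX K - opX K * a := rfl

lemma opX_injective : Function.Injective (opX K) := 

  (mul_right_injective₀ (Polynomial.X_ne_zero (R := K)) : Function.Injective fun p : K[X] => X * p)

/-- F is stable under ad x, and ad x is injective on it: if a commutes with x, then a v_{n+1} = 0
forces x a v_n = 0, so vanishing propagates down from the cutoff. -/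
lemma eq_zero_of_adX_pow (k : ℕ) : ∀ a ∈ F K, (adX K ^ k) a = 0 → a = 0 := by
  induction k with
  | zero => intro a _ h; simpa using h
  | succ k ih =>
    intro a ha h
    have hcomm : adX K a = 0 := by
      refine ih _ ?_ (by rwa [pow_succ, Module.End.mul_apply] at h)
      rw [adX_apply]
      exact sub_mem (F_mul_mem opX_mem ha) (mul_mem_F _ ha)
    rw [adX_apply, sub_eq_zero] at hcomm
    obtain ⟨N, hN⟩ := mem_F_iff.1 ha
    have hstep : ∀ n, a (divPow K (n + 1)) = 0 → a (divPow K n) = 0 := fun n hn => by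
      apply opX_injective
      rw [map_zero, ← Module.End.mul_apply, ← hcomm, Module.End.mul_apply, opX_divPow, map_smul,
        hn, smul_zero]
    have hall : ∀ M n, N ≤ n + M → a (divPow K n) = 0 := fun M => by
      induction M with
      | zero => exact fun n hn => hN n hn
      | succ M ih => exact fun n hn => hstep n (ih _ (by omega))
    exact (divPow K).ext fun n => hall N n (by omega)

lemma opD_pow_mul_opX (j : ℕ) :
    opD K ^ (j + 1) * opX K = opX K * opD K ^ (j + 1) + ((j : K) + 1) • opD K ^ j := by
  induction j with
  | zero => simpa using opD_mul_opX
  | succ j ih =>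
    rw [pow_succ', mul_assoc, ih, mul_add, ← mul_assoc, opD_mul_opX, add_mul, mul_assoc,
      ← pow_succ', one_mul, mul_smul_comm, ← pow_succ', add_assoc]
    congr 1
    push_cast
    module

lemma adX_pow_eq_zero {m n : ℕ} {a : Module.End K (Pol K)} (ha : a ∈ pbwSpan K m n) :
    (adX K ^ (n + 1)) a = 0 := by
  have : ∀ j i, (adX K ^ (j + 1)) (opX K ^ i * opD K ^ j) = 0 := by
    intro j
    induction j with
    | zero =>
      intro i
      rw [zero_add, pow_one, adX_apply, pow_zero, mul_one, ← pow_succ, ← pow_succ', sub_self]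
    | succ j ih =>
      intro i
      rw [pow_succ, Module.End.mul_apply, adX_apply, mul_assoc, opD_pow_mul_opX, mul_add,
        ← mul_assoc, ← pow_succ, ← mul_assoc, ← pow_succ', add_sub_cancel_left, mul_smul_comm,
        map_smul, ih, smul_zero]
  have h : pbwSpan K m n ≤ LinearMap.ker (adX K ^ (n + 1)) :=
    pbwSpan_induction fun i _ j hj => by
      rw [LinearMap.mem_ker, show n + 1 = (n - j) + (j + 1) by omega, pow_add,
        Module.End.mul_apply, this, map_zero]
  exact h ha

/-- The derivation ad x lowers the order in ∂, so it is locally nilpotent on A₁, whereas its powers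
are injective on F. -/
lemma A1_inf_F {a : Module.End K (Pol K)} (ha : a ∈ A1 K) (haF : a ∈ F K) : a = 0 := by
  obtain ⟨n, hn⟩ := exists_mem_pbwSpan ha
  exact eq_zero_of_adX_pow (n + 1) a haF (adX_pow_eq_zero hn)

/-! ### Operators of degree zero and invertibility -/

/-- Starting at index m + n leaves room for every ∂^j with j ≤ n, so one formula with polynomial
coefficients holds for all m. -/
lemma exists_band_form {n : ℕ} {a : Module.End K (Pol K)} (ha : a ∈ pbwSpan K n n) :
    ∃ q : ℕ → K[X], ∀ m : ℕ, a (divPow K (m + n)) =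
      ∑ i ∈ Finset.range (2 * n + 1), (q i).eval (m : K) • divPow K (m + i) := by
  induction ha using Submodule.span_induction with
  | mem a ha =>
    obtain ⟨⟨i, j⟩, hp, rfl⟩ := ha
    simp only [Finset.coe_product, Finset.coe_range, Set.mem_prod, Set.mem_Iio] at hp
    obtain ⟨p, hp'⟩ := exists_opX_pow_divPow (K := K) i
    -- ∂^j takes v_{m+n} to v_{m+n-j}; then x^i raises the index by i with coefficient p(m+n-j).
    refine ⟨Pi.single (n - j + i) (p.comp (X + Polynomial.C ((n - j : ℕ) : K))), fun m => ?_⟩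
    rw [Finset.sum_eq_single (n - j + i)]
    · have h := opD_pow_add (K := K) j (m + (n - j))
      rw [show m + (n - j) + j = m + n by omega] at h
      rw [pbw, Module.End.mul_apply, h, hp', Pi.single_eq_same, Polynomial.eval_comp, add_assoc]
      simp
    · intro k _ hk
      rw [Pi.single_eq_of_ne hk, Polynomial.eval_zero, zero_smul]
    · intro h
      exact absurd (Finset.mem_range.2 (by omega)) h
  | zero => exact ⟨0, fun m => by simp⟩
  | add a b _ _ ha hb =>
    obtain ⟨p, hp⟩ := ha
    obtain ⟨q, hq⟩ := hb
    refine ⟨p + q, fun m => ?_⟩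
    rw [LinearMap.add_apply, hp, hq, ← Finset.sum_add_distrib]
    exact Finset.sum_congr rfl fun i _ => by rw [Pi.add_apply, Polynomial.eval_add, add_smul]
  | smul c a _ ha =>
    obtain ⟨p, hp⟩ := ha
    refine ⟨c • p, fun m => ?_⟩
    rw [LinearMap.smul_apply, hp, Finset.smul_sum]
    exact Finset.sum_congr rfl fun i _ => by
      rw [Pi.smul_apply, Polynomial.eval_smul, smul_smul, smul_eq_mul]

variable (K) in
/-- The degree of an element of `Pol K` as a polynomial. -/
def polDegree (v : Pol K) : WithBot ℕ := Polynomial.degree (v : K[X])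

lemma degree_divPowPoly (n : ℕ) : (divPowPoly K n).degree = n := by
  rw [divPowPoly_apply, Polynomial.degree_monomial]
  exact inv_ne_zero (Nat.cast_ne_zero.2 n.factorial_ne_zero)

lemma degree_sum_divPowPoly (c : ℕ → K) (m d : ℕ) (hd : c d ≠ 0) :
    (∑ i ∈ Finset.range (d + 1), c i • divPowPoly K (m + i)).degree = ((m + d : ℕ) : WithBot ℕ) := by
  have h : (c d • divPowPoly K (m + d)).degree = ((m + d : ℕ) : WithBot ℕ) := by
    rw [Polynomial.degree_smul_of_smul_regular _ (IsSMulRegular.of_ne_zero hd),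
      degree_divPowPoly]
  rw [Finset.sum_range_succ, Polynomial.degree_add_eq_right_of_degree_lt, h]
  rw [h, ← Polynomial.mem_degreeLT]
  refine sum_mem fun i hi => Submodule.smul_mem _ _ ?_
  rw [Polynomial.mem_degreeLT, degree_divPowPoly]
  exact_mod_cast Nat.add_lt_add_left (Finset.mem_range.1 hi) m

/-- Polynomials with exactly one in each degree form a basis, so u carries a basis to a basis. -/
lemma isUnit_of_polDegree {u : Module.End K (Pol K)}
    (hu : ∀ k, polDegree K (u (divPow K k)) = k) : IsUnit u := by
  let S : Polynomial.Sequence K := ⟨fun k => (u (divPow K k) : K[X]), hu⟩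
  let B : Module.Basis ℕ K (Pol K) :=
    S.basis fun i => (Polynomial.leadingCoeff_ne_zero.2 (S.ne_zero i)).isUnit
  have hB : ∀ k, B k = u (divPow K k) := fun k => S.basis_eq_self _ k
  have : u = ((divPow K).equiv B (Equiv.refl ℕ)).toLinearMap :=
    (divPow K).ext fun k => by
      rw [LinearEquiv.coe_coe, Module.Basis.equiv_apply, Equiv.refl_apply, hB]
  rw [Module.End.isUnit_iff, this]
  exact LinearEquiv.bijective _

/-- The correction replaces the first N columns by those of the identity. -/
lemma exists_isUnit_add {u : Module.End K (Pol K)} (N : ℕ)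
    (hu : ∀ k ≥ N, polDegree K (u (divPow K k)) = k) : ∃ f ∈ F K, IsUnit (u + f) := by
  let f := ∑ k ∈ Finset.range N, col k (divPow K k - u (divPow K k))
  have hf : ∀ m, f (divPow K m) = if m ∈ Finset.range N then divPow K m - u (divPow K m) else 0 := by
    intro m
    rw [LinearMap.sum_apply]
    simp_rw [col_divPow]
    rw [Finset.sum_ite_eq]
  refine ⟨f, sum_mem fun k _ => Ecol_le_F k (col_mem_Ecol k _), isUnit_of_polDegree fun k => ?_⟩
  rw [LinearMap.add_apply, hf]
  split_ifs with h
  · rw [add_sub_cancel]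
    exact degree_divPowPoly k
  · rw [add_zero]
    exact hu k (by simpa using h)

variable (K) in
/-- The reduction of operators modulo compact operators. -/
abbrev modC : Module.End K (Pol K) →+* OperatorsModCompact K (Pol K) :=
  Ideal.Quotient.mk (compactIdeal K (Pol K))

lemma modC_eq_zero {f : Module.End K (Pol K)} : modC K f = 0 ↔ f ∈ compactIdeal K (Pol K) :=
  Ideal.Quotient.eq_zero_iff_mem

lemma modC_F {f : Module.End K (Pol K)} (hf : f ∈ F K) : modC K f = 0 :=
  modC_eq_zero.2 (F_le_compact hf)

instance : Nontrivial (OperatorsModCompact K (Pol K)) :=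
  ⟨1, 0, fun h => one_notMem_compact (modC_eq_zero.1 ((map_one (modC K)).trans h))⟩

lemma modC_opInt_mul_opD : modC K (opInt K) * modC K (opD K) = 1 := by
  rw [← map_mul, opInt_mul_opD, map_sub, modC_F (e_mem_F 0 0), sub_zero, map_one]

lemma modC_opD_mul_opInt : modC K (opD K) * modC K (opInt K) = 1 := by
  rw [← map_mul, opD_mul_opInt, map_one]

lemma isUnit_modC_opD : IsUnit (modC K (opD K)) :=
  ⟨⟨_, _, modC_opD_mul_opInt, modC_opInt_mul_opD⟩, rfl⟩

lemma isUnit_modC_opInt : IsUnit (modC K (opInt K)) :=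
  ⟨⟨_, _, modC_opInt_mul_opD, modC_opD_mul_opInt⟩, rfl⟩

lemma exists_nat_eval_ne_zero {p : K[X]} (hp : p ≠ 0) : ∃ M : ℕ, ∀ m ≥ M, p.eval (m : K) ≠ 0 := by
  have hfin : {x : K | p.IsRoot x}.Finite := Polynomial.finite_setOfPred_isRoot hp
  have hfin' := hfin.preimage (f := fun n : ℕ => (n : K)) (Nat.cast_injective.injOn)
  obtain ⟨M, hM⟩ := hfin'.bddAbove
  refine ⟨M + 1, fun m hm h => ?_⟩
  have := hM (show m ∈ _ from h)
  omega

/-- Far out, a shifts degrees by a constant, because the top nonzero band coefficient has only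
finitely many roots; c undoes that shift. -/
lemma exists_unit_of_A1 {a : Module.End K (Pol K)} (ha : a ∈ A1 K) (ha0 : a ≠ 0) :
    ∃ c ∈ I1 K, ∃ f ∈ F K, IsUnit (modC K c) ∧ IsUnit (a * c + f) := by
  obtain ⟨n, hn⟩ := exists_mem_pbwSpan ha
  obtain ⟨q, hq⟩ := exists_band_form hn
  -- The top band index d exists: if all coefficients were zero, a would kill v_k for k ≥ n, hence
  -- lie in F and be zero.
  obtain ⟨d, hd, hmax⟩ : ∃ d ≤ 2 * n, q d ≠ 0 ∧ ∀ i ≤ 2 * n, d < i → q i = 0 := by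
    classical
    have hex : ∃ i ≤ 2 * n, q i ≠ 0 := by
      by_contra! h
      refine ha0 (A1_inf_F ha (mem_F_iff.2 ⟨n, fun k hk => ?_⟩))
      obtain ⟨m, rfl⟩ := Nat.exists_eq_add_of_le' hk
      rw [hq]
      exact Finset.sum_eq_zero fun i hi => by
        rw [h i (by simpa [Nat.lt_succ_iff] using hi), Polynomial.eval_zero, zero_smul]
    obtain ⟨i, hi, hqi⟩ := hex
    refine ⟨Nat.findGreatest (fun i => q i ≠ 0) (2 * n), Nat.findGreatest_le _,
      Nat.findGreatest_spec (P := fun i => q i ≠ 0) hi hqi, fun i hi hlt => ?_⟩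
    exact not_not.1 (Nat.findGreatest_is_greatest (P := fun i => q i ≠ 0) hlt hi)
  obtain ⟨hqd, hmax⟩ := hmax
  obtain ⟨M, hM⟩ := exists_nat_eval_ne_zero hqd
  have hdeg : ∀ m ≥ M, polDegree K (a (divPow K (m + n))) = ((m + d : ℕ) : WithBot ℕ) := by
    intro m hm
    have : a (divPow K (m + n)) =
        ∑ i ∈ Finset.range (d + 1), (q i).eval (m : K) • divPow K (m + i) := by
      rw [hq]
      symm
      refine Finset.sum_subset (Finset.range_subset_range.2 (by omega)) fun i hi hi' => ?_
      rw [hmax i (by simpa [Nat.lt_succ_iff] using hi) (by simpa using hi'), Polynomial.eval_zero,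
        zero_smul]
    rw [this]
    exact degree_sum_divPowPoly (fun i => (q i).eval (m : K)) m d (hM m hm)
  obtain ⟨c, hc, hcu, hcb⟩ : ∃ c ∈ I1 K, IsUnit (modC K c) ∧
      ∀ m ≥ n, c (divPow K (m + d)) = divPow K (m + n) := by
    rcases le_total d n with h | h
    · refine ⟨opInt K ^ (n - d), pow_mem opInt_mem _, ?_, fun m _ => ?_⟩
      · rw [map_pow]; exact isUnit_modC_opInt.pow _
      · rw [opInt_pow_divPow, add_assoc, Nat.add_sub_cancel' h]
    · refine ⟨opD K ^ (d - n), pow_mem opD_mem _, ?_, fun m _ => ?_⟩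
      · rw [map_pow]; exact isUnit_modC_opD.pow _
      · rw [show m + d = m + n + (d - n) by omega, opD_pow_add]
  -- Beyond this cutoff k = m + d with m ≥ n and m ≥ M, so c moves v_k to v_{m+n} and a brings the
  -- degree back to k.
  obtain ⟨f, hf, hu⟩ := exists_isUnit_add (u := a * c) (n + M + d) fun k hk => by
    obtain ⟨m, rfl⟩ : ∃ m, k = m + d := ⟨k - d, by omega⟩
    rw [Module.End.mul_apply, hcb m (by omega), hdeg m (by omega)]
  exact ⟨c, hc, f, hf, hcu, hu⟩

/-! ### Reduction of integro-differential operators to the Weyl algebra -/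

/-- Induction through x^{i+1}∂ = ∂x^{i+1} - (i+1)x^i: each exchange spends one ∂ and lowers the
power of x in the remainder, and l > i leaves one ∂ at the end. -/
lemma exists_opD_mul_of_lt {i l : ℕ} (h : i < l) :
    ∃ b ∈ A1 K, opX K ^ i * opD K ^ l = opD K * b := by
  induction i generalizing l with
  | zero =>
    obtain ⟨l, rfl⟩ := Nat.exists_eq_add_of_lt h
    exact ⟨opD K ^ l, pow_mem opD_mem_A1 _, by rw [pow_zero, one_mul, zero_add, pow_succ']⟩
  | succ i ih =>
    obtain ⟨l, rfl⟩ : ∃ k, l = k + 1 := ⟨l - 1, by omega⟩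
    obtain ⟨b, hb, hb'⟩ := ih (show i < l by omega)
    refine ⟨opX K ^ (i + 1) * opD K ^ l - ((i : K) + 1) • b, sub_mem (mul_mem
      (pow_mem opX_mem_A1 _) (pow_mem opD_mem_A1 _)) (Subalgebra.smul_mem _ hb _), ?_⟩
    rw [mul_sub, ← mul_assoc, opD_mul_opX_pow, add_mul, mul_smul_comm, ← hb', smul_mul_assoc,
      add_sub_cancel_right, mul_assoc, ← pow_succ']

lemma exists_opD_mul {n : ℕ} {a : Module.End K (Pol K)} (ha : a ∈ pbwSpan K n n) :
    ∃ b ∈ A1 K, a * opD K ^ (n + 1) = opD K * b := by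
  have : pbwSpan K n n ≤ ((Subalgebra.toSubmodule (A1 K)).map
      (LinearMap.mulLeft K (opD K))).comap (LinearMap.mulRight K (opD K ^ (n + 1))) :=
    pbwSpan_induction fun i hi j hj => by
      obtain ⟨b, hb, hb'⟩ := exists_opD_mul_of_lt (K := K) (show i < j + (n + 1) by omega)
      refine ⟨b, hb, ?_⟩
      rw [LinearMap.mulLeft_apply, LinearMap.mulRight_apply, ← hb', pow_add, mul_assoc]
  obtain ⟨b, hb, hb'⟩ := this ha
  exact ⟨b, hb, hb'.symm⟩

/-- Enough powers of ∂ on the right absorb every ∫, up to F: an element of A₁ times a high power of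
∂ has the form ∂b, and ∫∂b = b - e_00 b. -/
lemma exists_A1_add_F {a : Module.End K (Pol K)} (ha : a ∈ I1 K) :
    ∃ k, ∀ l ≥ k, ∃ w ∈ A1 K, a * opD K ^ l - w ∈ F K := by
  let T : Set (Module.End K (Pol K)) := {a | ∃ k, ∃ w ∈ A1 K, a * opD K ^ k - w ∈ F K}
  have hmono : ∀ (a : Module.End K (Pol K)) (k l : ℕ), k ≤ l →
      (∃ w ∈ A1 K, a * opD K ^ k - w ∈ F K) → ∃ w ∈ A1 K, a * opD K ^ l - w ∈ F K := by
    rintro a k l hkl ⟨w, hw, h⟩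
    obtain ⟨j, rfl⟩ := Nat.exists_eq_add_of_le hkl
    refine ⟨w * opD K ^ j, mul_mem hw (pow_mem opD_mem_A1 _), ?_⟩
    rw [pow_add, ← mul_assoc, ← sub_mul]
    exact F_mul_mem (pow_mem opD_mem _) h
  -- Closure of T under left multiplication by a passes to products of generators, which membership
  -- of a alone does not; applied to 1 it gives the claim.
  suffices h : ∀ t ∈ T, a * t ∈ T by
    obtain ⟨k, hk⟩ := h 1 ⟨0, 1, one_mem _, by simp⟩
    rw [mul_one] at hk
    exact ⟨k, fun l hl => hmono a k l hl hk⟩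
  induction ha using Algebra.adjoin_induction with
  | mem a ha =>
    rintro t ⟨k, w, hw, h⟩
    rcases ha with rfl | rfl | rfl
    · exact ⟨k, _, mul_mem opX_mem_A1 hw, by rw [mul_assoc, ← mul_sub]; exact mul_mem_F _ h⟩
    · exact ⟨k, _, mul_mem opD_mem_A1 hw, by rw [mul_assoc, ← mul_sub]; exact mul_mem_F _ h⟩
    · obtain ⟨n, hn⟩ := exists_mem_pbwSpan hw
      obtain ⟨b, hb, hb'⟩ := exists_opD_mul hn
      refine ⟨k + (n + 1), b, hb, ?_⟩
      -- Both error terms lie in F: the first comes from the error of t, the second from ∫∂ = 1 -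
      -- e_00.
      have : opInt K * t * opD K ^ (k + (n + 1)) - b =
          opInt K * ((t * opD K ^ k - w) * opD K ^ (n + 1)) - e K 0 0 * b := by
        rw [sub_mul, hb', mul_sub, ← mul_assoc (opInt K) (opD K), opInt_mul_opD, sub_mul, one_mul,
          pow_add]
        simp only [mul_assoc]
        abel
      rw [this]
      exact sub_mem (mul_mem_F _ (F_mul_mem (pow_mem opD_mem _) h))
        (F_mul_mem (A1_le_I1 K hb) (e_mem_F 0 0))
  | algebraMap c =>
    rintro t ⟨k, w, hw, h⟩
    refine ⟨k, c • w, Subalgebra.smul_mem _ hw _, ?_⟩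
    rw [← Algebra.smul_def, smul_mul_assoc, ← smul_sub]
    exact Submodule.smul_mem _ _ h
  | add a b _ _ ha hb =>
    intro t ht
    obtain ⟨k, hk⟩ := ha t ht
    obtain ⟨l, hl⟩ := hb t ht
    obtain ⟨v, hv, hv'⟩ := hmono _ k (k + l) (by omega) hk
    obtain ⟨w, hw, hw'⟩ := hmono _ l (k + l) (by omega) hl
    refine ⟨k + l, v + w, add_mem hv hw, ?_⟩
    rw [add_mul, add_mul, add_sub_add_comm]
    exact add_mem hv' hw'
  | mul a b _ _ ha hb => intro t ht; rw [mul_assoc]; exact ha _ (hb t ht)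

/-- Apply the Weyl algebra case to w ≡ a∂^k; here w ≠ 0, since otherwise a = (a∂^k)∫^k would be in
F. The error times c is moved into the correction from F. -/
lemma exists_unit_of_notMem_F {a : Module.End K (Pol K)} (ha : a ∈ I1 K) (haF : a ∉ F K) :
    ∃ c ∈ I1 K, ∃ f ∈ F K, IsUnit (modC K c) ∧ IsUnit (a * c + f) := by
  obtain ⟨k, hk⟩ := exists_A1_add_F ha
  obtain ⟨w, hw, h⟩ := hk k le_rfl
  have hw0 : w ≠ 0 := by
    rintro rfl
    refine haF ?_
    have := F_mul_mem (pow_mem opInt_mem k) h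
    rwa [sub_zero, mul_assoc, opD_pow_mul_opInt_pow, mul_one] at this
  obtain ⟨c, hc, f, hf, hcu, hu⟩ := exists_unit_of_A1 hw hw0
  refine ⟨opD K ^ k * c, mul_mem (pow_mem opD_mem _) hc, f - (a * opD K ^ k - w) * c,
    sub_mem hf (F_mul_mem hc h), ?_, ?_⟩
  · rw [map_mul, map_pow]
    exact ((isUnit_modC_opD (K := K)).pow k).mul hcu
  · convert hu using 1
    rw [sub_mul, mul_assoc]
    abel

/-- Modulo compacts f disappears, so ac is a unit, and c is a unit there too. -/
lemma isUnit_modC_of_notMem_F {a : Module.End K (Pol K)} (ha : a ∈ I1 K) (haF : a ∉ F K) :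
    IsUnit (modC K a) := by
  obtain ⟨c, hc, f, hf, hcu, hu⟩ := exists_unit_of_notMem_F ha haF
  have h := hu.map (modC K)
  rw [map_add, modC_F hf, add_zero, map_mul] at h
  obtain ⟨c', hc'⟩ := hcu
  rw [← hc'] at h
  exact (Units.isUnit_mul_units (modC K a) c').1 h

lemma mem_F_iff_compact {a : Module.End K (Pol K)} (ha : a ∈ I1 K) :
    a ∈ F K ↔ a ∈ compactIdeal K (Pol K) := by
  refine ⟨F_le_compact, fun h => ?_⟩
  by_contra haF
  have := isUnit_modC_of_notMem_F ha haF
  rw [modC_eq_zero.2 h] at this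
  exact not_isUnit_zero (M₀ := OperatorsModCompact K (Pol K)) this

/-! ### Ore conditions -/

lemma finrank_pbwSpan (n : ℕ) : Module.finrank K (pbwSpan K n n) = (n + 1) * (n + 1) := by
  have hli : LinearIndependent K (fun p : (Finset.range (n + 1) ×ˢ Finset.range (n + 1) :
      Finset (ℕ × ℕ)) => pbw K p) := linearIndependent_pbw.comp _ Subtype.val_injective
  have h := finrank_span_eq_card hli
  have hr : Set.range (fun p : (Finset.range (n + 1) ×ˢ Finset.range (n + 1) :
      Finset (ℕ × ℕ)) => pbw K p) = pbw K '' ((Finset.range (n + 1) ×ˢ Finset.range (n + 1) :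
        Finset (ℕ × ℕ)) : Set (ℕ × ℕ)) := by
    ext a
    simp
  rw [hr] at h
  rw [pbwSpan, h]
  simp

instance finiteDimensional_pbwSpan (m n : ℕ) : FiniteDimensional K (pbwSpan K m n) :=
  FiniteDimensional.span_of_finite K ((Finset.finite_toSet _).image _)

/-- Two copies of a space of dimension (n+1)² cannot embed in one of dimension (n+c+1)² for large n.
Taking left or right multiplications for φ and ψ gives both Ore conditions. -/
lemma exists_apply_eq_apply (φ ψ : Module.End K (Module.End K (Pol K))) (c : ℕ)
    (hφ : ∀ n, ∀ a ∈ pbwSpan K n n, φ a ∈ pbwSpan K (n + c) (n + c))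
    (hψ : ∀ n, ∀ a ∈ pbwSpan K n n, ψ a ∈ pbwSpan K (n + c) (n + c)) :
    ∃ t ∈ A1 K, ∃ b ∈ A1 K, φ t = ψ b ∧ (t ≠ 0 ∨ b ≠ 0) := by
  -- This n suffices: 2(3c+1)² = 18c²+12c+2 exceeds (4c+1)² = 16c²+8c+1.
  let n := 3 * c
  let Φ : pbwSpan K n n × pbwSpan K n n →ₗ[K] pbwSpan K (n + c) (n + c) :=
    (φ.restrict (hφ n)).comp (LinearMap.fst K _ _) - (ψ.restrict (hψ n)).comp (LinearMap.snd K _ _)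
  have hlt : Module.finrank K (pbwSpan K (n + c) (n + c)) <
      Module.finrank K (pbwSpan K n n × pbwSpan K n n) := by
    rw [Module.finrank_prod, finrank_pbwSpan, finrank_pbwSpan]
    simp only [n]
    nlinarith
  have hker := LinearMap.ker_ne_bot_of_finrank_lt (f := Φ) hlt
  obtain ⟨⟨t, b⟩, hx, hx0⟩ := Submodule.exists_mem_ne_zero_of_ne_bot hker
  refine ⟨t, pbwSpan_le_A1 _ _ t.2, b, pbwSpan_le_A1 _ _ b.2, ?_, ?_⟩
  · have := congrArg Subtype.val (LinearMap.mem_ker.1 hx)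
    exact sub_eq_zero.1 this
  · by_contra! h
    exact hx0 (Prod.ext (Subtype.ext h.1) (Subtype.ext h.2))

lemma isUnit_modC_of_A1 {a : Module.End K (Pol K)} (ha : a ∈ A1 K) (ha0 : a ≠ 0) :
    IsUnit (modC K a) :=
  isUnit_modC_of_notMem_F (A1_le_I1 K ha) fun h => ha0 (A1_inf_F ha h)

lemma A1_mul_ne_zero {a b : Module.End K (Pol K)} (ha : a ∈ A1 K) (hb : b ∈ A1 K) (ha0 : a ≠ 0)
    (hb0 : b ≠ 0) : a * b ≠ 0 := fun h => by
  have := (isUnit_modC_of_A1 ha ha0).mul (isUnit_modC_of_A1 hb hb0)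
  rw [← map_mul, h, map_zero] at this
  exact not_isUnit_zero (M₀ := OperatorsModCompact K (Pol K)) this

lemma A1_rightOre {r s : Module.End K (Pol K)} (hr : r ∈ A1 K) (hs : s ∈ A1 K) (hs0 : s ≠ 0) :
    ∃ t ∈ A1 K, t ≠ 0 ∧ ∃ b ∈ A1 K, r * t = s * b := by
  obtain ⟨c, hc⟩ := exists_mem_pbwSpan hr
  obtain ⟨d, hd⟩ := exists_mem_pbwSpan hs
  obtain ⟨t, ht, b, hb, h, h0⟩ := exists_apply_eq_apply (LinearMap.mulLeft K r)
    (LinearMap.mulLeft K s) (c + d)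
    (fun n a ha => pbwSpan_mono (by omega) (by omega) (mul_mem_pbwSpan hc ha))
    (fun n a ha => pbwSpan_mono (by omega) (by omega) (mul_mem_pbwSpan hd ha))
  refine ⟨t, ht, ?_, b, hb, h⟩
  rintro rfl
  refine A1_mul_ne_zero hs hb hs0 (h0.resolve_left fun h => h rfl) ?_
  simpa using h.symm

lemma A1_leftOre {r s : Module.End K (Pol K)} (hr : r ∈ A1 K) (hs : s ∈ A1 K) (hs0 : s ≠ 0) :
    ∃ t ∈ A1 K, t ≠ 0 ∧ ∃ b ∈ A1 K, t * r = b * s := by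
  obtain ⟨c, hc⟩ := exists_mem_pbwSpan hr
  obtain ⟨d, hd⟩ := exists_mem_pbwSpan hs
  obtain ⟨t, ht, b, hb, h, h0⟩ := exists_apply_eq_apply (LinearMap.mulRight K r)
    (LinearMap.mulRight K s) (c + d)
    (fun n a ha => pbwSpan_mono (by omega) (by omega) (mul_mem_pbwSpan ha hc))
    (fun n a ha => pbwSpan_mono (by omega) (by omega) (mul_mem_pbwSpan ha hd))
  refine ⟨t, ht, ?_, b, hb, h⟩
  rintro rfl
  refine A1_mul_ne_zero hb hs (h0.resolve_left fun h => h rfl) hs0 ?_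
  simpa using h.symm

lemma notMem_F_of_isUnit_modC {a : Module.End K (Pol K)} (h : IsUnit (modC K a)) : a ∉ F K :=
  fun ha => not_isUnit_zero (M₀ := OperatorsModCompact K (Pol K)) (modC_F ha ▸ h)

lemma ne_zero_of_sub_mem_F {a w : Module.End K (Pol K)} {k : ℕ} (ha : IsUnit (modC K a))
    (h : a * opD K ^ k - w ∈ F K) : w ≠ 0 := by
  rintro rfl
  rw [sub_zero] at h
  refine notMem_F_of_isUnit_modC ?_ h
  rw [map_mul, map_pow]
  exact ha.mul ((isUnit_modC_opD (K := K)).pow k)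

/-- With D = ∂^{k+l}, rD ≡ w and uD ≡ v modulo F, a common multiple wt = vb in A₁ makes rDt and uDb
agree modulo F. Turn Dt into a unit; the remaining error g in F is absorbed on the other side as
u⁻¹g, which is again in F because F is a left ideal of all operators. -/
lemma I1_rightOre {r : Module.End K (Pol K)} (hr : r ∈ I1 K) (u : (Module.End K (Pol K))ˣ)
    (hu : (u : Module.End K (Pol K)) ∈ I1 K) :
    ∃ t : (Module.End K (Pol K))ˣ, (t : Module.End K (Pol K)) ∈ I1 K ∧ ∃ b ∈ I1 K,
      r * t = u * b := by
  obtain ⟨k, hk⟩ := exists_A1_add_F hr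
  obtain ⟨l, hl⟩ := exists_A1_add_F hu
  obtain ⟨w, hw, hrw⟩ := hk (k + l) (by omega)
  obtain ⟨v, hv, huv⟩ := hl (k + l) (by omega)
  obtain ⟨t, ht, ht0, b, hb, htb⟩ := A1_rightOre hw hv
    (ne_zero_of_sub_mem_F (u.isUnit.map (modC K)) huv)
  set D := opD K ^ (k + l) with hD
  have hDm : D ∈ I1 K := pow_mem opD_mem _
  have ht' : D * t ∉ F K := by
    refine notMem_F_of_isUnit_modC ?_
    rw [map_mul, hD, map_pow]
    exact ((isUnit_modC_opD (K := K)).pow _).mul (isUnit_modC_of_A1 ht ht0)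
  obtain ⟨c, hc, f, hf, -, ⟨y, hy⟩⟩ := exists_unit_of_notMem_F (mul_mem hDm (A1_le_I1 K ht)) ht'
  -- This is the error r y - u(Dbc), after wt = vb cancels.
  have hg : (r * D - w) * t * c - (u * D - v) * b * c + r * f ∈ F K :=
    add_mem (sub_mem (F_mul_mem hc (F_mul_mem (A1_le_I1 K ht) hrw))
      (F_mul_mem hc (F_mul_mem (A1_le_I1 K hb) huv))) (mul_mem_F _ hf)
  have hg' := mul_mem_F (↑u⁻¹ : Module.End K (Pol K)) hg
  refine ⟨y, hy ▸ add_mem (mul_mem (mul_mem hDm (A1_le_I1 K ht)) hc) (F_le_I1 hf),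
    _, add_mem (mul_mem (mul_mem hDm (A1_le_I1 K hb)) hc) (F_le_I1 hg'), ?_⟩
  rw [hy, mul_add, mul_add, Units.mul_inv_cancel_left, sub_mul, sub_mul, sub_mul, sub_mul, htb]
  simp only [mul_assoc]
  abel

lemma mem_tI1_of_I1 {a : Module.End K (Pol K)} (ha : a ∈ I1 K) : a ∈ tI1 K := I1_le_tI1 K ha

lemma inv_mem_tI1 {u : (Module.End K (Pol K))ˣ} (hu : (u : Module.End K (Pol K)) ∈ I1 K) :
    (↑u⁻¹ : Module.End K (Pol K)) ∈ tI1 K := Algebra.subset_adjoin (Or.inr ⟨u, hu, rfl⟩)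

/-- The right Ore condition supplies common denominators for sums and moves u⁻¹ past numerators in
products, so the fractions already form an algebra. -/
lemma mem_tI1_iff {a : Module.End K (Pol K)} :
    a ∈ tI1 K ↔ ∃ r ∈ I1 K, ∃ u : (Module.End K (Pol K))ˣ, (u : Module.End K (Pol K)) ∈ I1 K ∧
      a = r * (↑u⁻¹ : Module.End K (Pol K)) := by
  constructor
  · intro ha
    induction ha using Algebra.adjoin_induction with
    | mem a ha =>
      rcases ha with ha | ⟨u, hu, rfl⟩
      · exact ⟨a, ha, 1, one_mem _, by simp⟩
      · exact ⟨1, one_mem _, u, hu, by simp⟩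
    | algebraMap c => exact ⟨_, algebraMap_mem _ c, 1, one_mem _, by simp⟩
    | add a b _ _ ha hb =>
      obtain ⟨r, hr, u, hu, rfl⟩ := ha
      obtain ⟨s, hs, v, hv, rfl⟩ := hb
      obtain ⟨t, ht, b, hb, h⟩ := I1_rightOre hu v hv
      refine ⟨r * t + s * b, add_mem (mul_mem hr ht) (mul_mem hs hb), u * t, mul_mem hu ht, ?_⟩
      have hb' : b = ↑v⁻¹ * (↑(u * t) : Module.End K (Pol K)) := by
        rw [Units.val_mul, h, Units.inv_mul_cancel_left]
      rw [add_mul, hb', ← mul_assoc s, Units.mul_inv_cancel_right, mul_inv_rev, Units.val_mul,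
        mul_assoc r, Units.mul_inv_cancel_left]
    | mul a b _ _ ha hb =>
      obtain ⟨r, hr, u, hu, rfl⟩ := ha
      obtain ⟨s, hs, v, hv, rfl⟩ := hb
      obtain ⟨t, ht, b, hb, h⟩ := I1_rightOre hs u hu
      refine ⟨r * b, mul_mem hr hb, v * t, mul_mem hv ht, ?_⟩
      have hb' : b = ↑u⁻¹ * (s * t) := by rw [h, Units.inv_mul_cancel_left]
      rw [hb', mul_inv_rev, Units.val_mul]
      simp only [mul_assoc, Units.mul_inv_cancel_left]
  · rintro ⟨r, hr, u, hu, rfl⟩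
    exact mul_mem (mem_tI1_of_I1 hr) (inv_mem_tI1 hu)

lemma F_le_tI1 {f : Module.End K (Pol K)} (hf : f ∈ F K) : f ∈ tI1 K := mem_tI1_of_I1 (F_le_I1 hf)

lemma mem_FS_iff {a : Module.End K (Pol K)} :
    a ∈ FS K ↔ ∃ f ∈ F K, ∃ u : (Module.End K (Pol K))ˣ, (u : Module.End K (Pol K)) ∈ I1 K ∧
      a = f * (↑u⁻¹ : Module.End K (Pol K)) := by
  constructor
  · rintro ⟨f, hf, _, ⟨u, hu, rfl⟩, rfl⟩
    exact ⟨f, hf, u, hu, rfl⟩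
  · rintro ⟨f, hf, u, hu, rfl⟩
    exact ⟨f, hf, _, ⟨u, hu, rfl⟩, rfl⟩

/-- Cancelling the unit, r u⁻¹ is compact exactly when r is, and a compact r in I₁ lies in F. -/
lemma mem_FS_iff_compact {a : Module.End K (Pol K)} :
    a ∈ FS K ↔ a ∈ tI1 K ∧ a ∈ compactIdeal K (Pol K) := by
  rw [mem_FS_iff]
  constructor
  · rintro ⟨f, hf, u, hu, rfl⟩
    exact ⟨mul_mem (F_le_tI1 hf) (inv_mem_tI1 hu), Ideal.mul_mem_right _ _ (F_le_compact hf)⟩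
  · rintro ⟨ha, hc⟩
    obtain ⟨r, hr, u, hu, rfl⟩ := mem_tI1_iff.1 ha
    refine ⟨r, (mem_F_iff_compact hr).2 ?_, u, hu, rfl⟩
    have := Ideal.mul_mem_right (I := compactIdeal K (Pol K)) (u : Module.End K (Pol K)) hc
    rwa [Units.inv_mul_cancel_right] at this

/-- If a = r u⁻¹ and rc + f = y is an automorphism, then a·(u c y⁻¹) = 1 - f y⁻¹. Since a is a unit
modulo compacts, this right inverse is two-sided there; the point is that it lies in Ĩ₁. -/
lemma exists_inv_modC {a : Module.End K (Pol K)} (ha : a ∈ tI1 K)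
    (hc : a ∉ compactIdeal K (Pol K)) :
    ∃ b ∈ tI1 K, modC K a * modC K b = 1 ∧ modC K b * modC K a = 1 := by
  obtain ⟨r, hr, u, hu, rfl⟩ := mem_tI1_iff.1 ha
  have hrF : r ∉ F K := fun h => hc (Ideal.mul_mem_right _ _ (F_le_compact h))
  obtain ⟨c, hc', f, hf, -, ⟨y, hy⟩⟩ := exists_unit_of_notMem_F hr hrF
  have hunit : IsUnit (modC K (r * (↑u⁻¹ : Module.End K (Pol K)))) := by
    rw [map_mul]
    exact (isUnit_modC_of_notMem_F hr hrF).mul (u⁻¹.isUnit.map (modC K))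
  have hyI : (y : Module.End K (Pol K)) ∈ I1 K :=
    hy ▸ add_mem (mul_mem hr hc') (F_le_I1 hf)
  have h1 : modC K (r * (↑u⁻¹ : Module.End K (Pol K))) *
      modC K (u * c * (↑y⁻¹ : Module.End K (Pol K))) = 1 := by
    have h : r * (↑u⁻¹ : Module.End K (Pol K)) * (u * c * (↑y⁻¹ : Module.End K (Pol K))) =
        1 - f * (↑y⁻¹ : Module.End K (Pol K)) := by
      rw [eq_sub_iff_add_eq, ← y.mul_inv, hy, add_mul]
      simp only [mul_assoc, Units.inv_mul_cancel_left]
    rw [← map_mul, h, map_sub, map_one, map_mul, modC_F hf, zero_mul, sub_zero]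
  refine ⟨u * c * (↑y⁻¹ : Module.End K (Pol K)), mul_mem (mul_mem (mem_tI1_of_I1 hu)
    (mem_tI1_of_I1 hc')) (inv_mem_tI1 hyI), h1, ?_⟩
  obtain ⟨z, hz⟩ := hunit
  rw [← hz] at h1 ⊢
  rw [← Units.inv_eq_of_mul_eq_one_right h1, Units.inv_mul]

/-- The kernel of a lies in the image of ba - 1, and the image of ab - 1 surjects onto the cokernel
of a. -/
lemma isFredholmMap_of_mul_eq_one {V : Type v} [AddCommGroup V] [Module K V]
    {a b : Module.End K V}
    (hab : a * b - 1 ∈ compactIdeal K V) (hba : b * a - 1 ∈ compactIdeal K V) :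
    IsFredholmMap a := by
  have hab' : FiniteDimensional K (LinearMap.range (a * b - 1)) := hab
  have hba' : FiniteDimensional K (LinearMap.range (b * a - 1)) := hba
  constructor
  · refine Submodule.finiteDimensional_of_le (S₂ := LinearMap.range (b * a - 1)) fun v hv => ?_
    refine ⟨-v, ?_⟩
    rw [LinearMap.sub_apply, Module.End.mul_apply, Module.End.one_apply, map_neg,
      LinearMap.mem_ker.1 hv]
    simp
  · have hs : Function.Surjective ((LinearMap.range a).mkQ.comp
        (LinearMap.range (a * b - 1)).subtype) := fun q => by
      obtain ⟨v, rfl⟩ := Submodule.mkQ_surjective _ q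
      refine ⟨⟨(a * b - 1) (-v), LinearMap.mem_range_self _ _⟩, ?_⟩
      rw [LinearMap.comp_apply, ← sub_eq_zero, ← map_sub, Submodule.mkQ_apply,
        Submodule.Quotient.mk_eq_zero]
      refine ⟨b (-v), ?_⟩
      simp
    exact Module.Finite.of_surjective _ hs

lemma isFredholmMap_of_notMem_compact {a : Module.End K (Pol K)} (ha : a ∈ tI1 K)
    (hc : a ∉ compactIdeal K (Pol K)) : IsFredholmMap a := by
  obtain ⟨b, -, hab, hba⟩ := exists_inv_modC ha hc
  refine isFredholmMap_of_mul_eq_one (b := b) ?_ ?_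
  · rw [← modC_eq_zero, map_sub, map_mul, hab, map_one, sub_self]
  · rw [← modC_eq_zero, map_sub, map_mul, hba, map_one, sub_self]

/-! ### Localization of `I₁` at `I₁⁰` -/

lemma I10inv_mul_F : I10inv K * (F K : Set (Module.End K (Pol K))) = F K := by
  ext a
  constructor
  · rintro ⟨b, -, f, hf, rfl⟩
    exact mul_mem_F b hf
  · exact fun ha => ⟨1, ⟨1, one_mem _, by simp⟩, a, ha, one_mul a⟩

/-- Take u = 1 - ∂. Its inverse maps v_n to v_n + ... + v_0, so e_00 u⁻¹ has no zero column. -/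
lemma exists_F_mul_inv_notMem_F : ∃ u : (Module.End K (Pol K))ˣ,
    (u : Module.End K (Pol K)) ∈ I1 K ∧ e K 0 0 * (↑u⁻¹ : Module.End K (Pol K)) ∉ F K := by
  have hu : IsUnit (1 - opD K) := by
    refine isUnit_of_polDegree fun k => ?_
    rw [LinearMap.sub_apply, Module.End.one_apply]
    cases k with
    | zero =>
      rw [opD_zero, sub_zero]
      exact degree_divPowPoly 0
    | succ k =>
      rw [opD_succ]
      refine (Polynomial.degree_sub_eq_left_of_degree_lt ?_).trans (degree_divPowPoly (k + 1))
      refine (degree_divPowPoly (K := K) k).trans_lt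
        (lt_of_lt_of_eq ?_ (degree_divPowPoly (K := K) (k + 1)).symm)
      exact_mod_cast Nat.lt_succ_self k
  obtain ⟨u, hu⟩ := hu
  refine ⟨u, hu ▸ sub_mem (one_mem _) opD_mem, fun h => ?_⟩
  obtain ⟨N, hN⟩ := mem_F_iff.1 h
  have hstep : ∀ n, (e K 0 0 * (↑u⁻¹ : Module.End K (Pol K))) (divPow K n) = divPow K 0 := by
    intro n
    rw [Module.End.mul_apply]
    induction n with
    | zero =>
      have : (u : Module.End K (Pol K)) (divPow K 0) = divPow K 0 := by
        rw [hu, LinearMap.sub_apply, opD_zero, sub_zero, Module.End.one_apply]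
      have h2 := congrArg (↑u⁻¹ : Module.End K (Pol K)) this
      rw [← Module.End.mul_apply, Units.inv_mul, Module.End.one_apply] at h2
      rw [← h2, e_divPow_self]
    | succ n ih =>
      have h1 : (u : Module.End K (Pol K)) (divPow K (n + 1)) = divPow K (n + 1) - divPow K n := by
        rw [hu, LinearMap.sub_apply, opD_succ, Module.End.one_apply]
      have h2 := congrArg (↑u⁻¹ : Module.End K (Pol K)) h1
      rw [← Module.End.mul_apply, Units.inv_mul, Module.End.one_apply, map_sub,
        eq_sub_iff_add_eq] at h2
      rw [← h2, map_add, ih, e_divPow, if_neg n.succ_ne_zero, zero_add]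
  have h0 := hN N le_rfl
  rw [hstep] at h0
  exact (divPow K).ne_zero 0 h0

lemma F_ssubset_FS : (F K : Set (Module.End K (Pol K))) ⊂ FS K := by
  refine ⟨fun f hf => mem_FS_iff.2 ⟨f, hf, 1, one_mem _, by simp⟩, fun h => ?_⟩
  obtain ⟨u, hu, hn⟩ := exists_F_mul_inv_notMem_F (K := K)
  exact hn (h (mem_FS_iff.2 ⟨_, e_mem_F 0 0, u, hu, rfl⟩))

lemma mem_I10_iff {s : I1 K} : s ∈ I10 K ↔ IsUnit (s : Module.End K (Pol K)) := Iff.rfl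

lemma isRightOreSet_I10 : IsRightOreSet (I10 K) := by
  rintro r s ⟨u, hu⟩
  have hs : (u : Module.End K (Pol K)) = s := hu
  obtain ⟨t, ht, b, hb, h⟩ := I1_rightOre r.2 u (hs ▸ s.2)
  exact ⟨⟨t, ht⟩, t.isUnit, ⟨b, hb⟩, Subtype.ext (by simpa [hs] using h)⟩

/-- A relation y e_00 = b u with y invertible makes b compact, hence in F; then e_00 u⁻¹ = y⁻¹ b
would be in F, against the example with 1 - ∂. -/
lemma not_isLeftOreSet_I10 : ¬ IsLeftOreSet (I10 K) := by
  intro hO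
  obtain ⟨u, hu, hn⟩ := exists_F_mul_inv_notMem_F (K := K)
  obtain ⟨t, ⟨y, hy⟩, b, h⟩ := hO ⟨e K 0 0, e_mem_I1 0 0⟩ ⟨u, hu⟩ u.isUnit
  have hy' : (y : Module.End K (Pol K)) = t := hy
  have h' : (y : Module.End K (Pol K)) * e K 0 0 = b * u := by
    rw [hy']
    exact congrArg Subtype.val h
  have hb : (b : Module.End K (Pol K)) ∈ F K := by
    refine (mem_F_iff_compact b.2).2 ?_
    rw [← Units.mul_inv_cancel_right (b : Module.End K (Pol K)) u, ← h']
    exact Ideal.mul_mem_right _ _ (Ideal.mul_mem_left _ _ (F_le_compact (e_mem_F 0 0)))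
  refine hn ?_
  rw [← Units.inv_mul_cancel_left y (e K 0 0), h', mul_assoc, mul_assoc, Units.mul_inv, mul_one]
  exact mul_mem_F _ hb

/-- An operator in `I₁⁰`, as a unit of `Ĩ₁`. -/
def unitTI1 (u : (Module.End K (Pol K))ˣ) (hu : (u : Module.End K (Pol K)) ∈ I1 K) : (tI1 K)ˣ where
  val := ⟨u, mem_tI1_of_I1 hu⟩
  inv := ⟨↑u⁻¹, inv_mem_tI1 hu⟩
  val_inv := Subtype.ext u.mul_inv
  inv_val := Subtype.ext u.inv_mul

lemma coe_inclI1 (a : I1 K) : (inclI1 K a : Module.End K (Pol K)) = a :=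
  Subalgebra.coe_inclusion _ a

lemma inclI1_injective : Function.Injective (inclI1 K) := Subalgebra.inclusion_injective _

lemma exists_frac_tI1 (q : tI1 K) : ∃ r : I1 K, ∃ s ∈ I10 K, ∃ u : (tI1 K)ˣ,
    (u : tI1 K) = inclI1 K s ∧ q = inclI1 K r * (↑u⁻¹ : tI1 K) := by
  obtain ⟨r, hr, u, hu, h⟩ := mem_tI1_iff.1 q.2
  exact ⟨⟨r, hr⟩, ⟨u, hu⟩, u.isUnit, unitTI1 u hu, rfl, Subtype.ext h⟩

lemma isRightQuotientRing_tI1 : IsRightQuotientRing (I10 K) (inclI1 K).toRingHom where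
  isUnit := by
    rintro s ⟨u, hu⟩
    have hs : (u : Module.End K (Pol K)) = s := hu
    exact ⟨unitTI1 u (hs ▸ s.2), Subtype.ext hs⟩
  exists_frac := exists_frac_tI1
  ker r := by
    constructor
    · intro h
      refine ⟨1, one_mem _, ?_⟩
      rw [mul_one]
      exact inclI1_injective (h.trans (map_zero (inclI1 K)).symm)
    · rintro ⟨s, hs, h⟩
      obtain ⟨u, hu⟩ := mem_I10_iff.1 hs
      have h' : (r : Module.End K (Pol K)) * u = 0 := by
        rw [hu]
        exact congrArg Subtype.val h
      exact Subtype.ext ((Units.mul_left_eq_zero u).1 h')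

/-! ### The ideals of `Ĩ₁` -/

lemma mem_C_iff {a : tI1 K} : a ∈ C K ↔ (a : Module.End K (Pol K)) ∈ compactIdeal K (Pol K) :=
  Iff.rfl

variable (K) in
/-- The matrix unit `e_{ij}` as an element of `Ĩ₁`. -/
def E (i j : ℕ) : tI1 K := ⟨e K i j, F_le_tI1 (e_mem_F i j)⟩

lemma E_mul_E (i j l : ℕ) : E K i j * E K j l = E K i l := Subtype.ext (e_mul_e_self i j l)

lemma E_ne_zero (i j : ℕ) : E K i j ≠ 0 := fun h => e_ne_zero i j (congrArg Subtype.val h)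

lemma E_mem_C (i j : ℕ) : E K i j ∈ C K := F_le_compact (e_mem_F i j)

lemma asOps_C : asOps K (C K : Set (tI1 K)) = FS K := by
  ext a
  rw [mem_FS_iff_compact]
  constructor
  · rintro ⟨b, hb, rfl⟩
    exact ⟨b.2, hb⟩
  · rintro ⟨ha, hc⟩
    exact ⟨⟨a, ha⟩, hc, rfl⟩

lemma exists_of_mem_C {c : tI1 K} (hc : c ∈ C K) : ∃ f : tI1 K,
    (f : Module.End K (Pol K)) ∈ F K ∧ ∃ u : (tI1 K)ˣ, c = f * (↑u⁻¹ : tI1 K) := by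
  obtain ⟨f, hf, u, hu, h⟩ := mem_FS_iff.1 (mem_FS_iff_compact.2 ⟨c.2, hc⟩)
  exact ⟨⟨f, F_le_tI1 hf⟩, hf, unitTI1 u hu, Subtype.ext h⟩

lemma F_subset_of_E_mem {W : Submodule K (tI1 K)} (hW : ∀ i j, E K i j ∈ W) {f : tI1 K}
    (hf : (f : Module.End K (Pol K)) ∈ F K) : f ∈ W := by
  have h : F K ≤ W.map (tI1 K).val.toLinearMap :=
    Submodule.span_le.2 (by rintro _ ⟨p, rfl⟩; exact ⟨_, hW p.1 p.2, rfl⟩)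
  obtain ⟨g, hg, hgf⟩ := h hf
  rwa [← Subtype.ext (a1 := g) (a2 := f) hgf]

lemma exists_inv_mod_C {a : tI1 K} (ha : a ∉ C K) :
    ∃ b : tI1 K, a * b - 1 ∈ C K ∧ b * a - 1 ∈ C K := by
  obtain ⟨b, hb, hab, hba⟩ := exists_inv_modC a.2 ha
  refine ⟨⟨b, hb⟩, ?_, ?_⟩
  · refine modC_eq_zero.1 ?_
    change modC K (a * b - 1) = 0
    rw [map_sub, map_mul, hab, map_one, sub_self]
  · refine modC_eq_zero.1 ?_
    change modC K (b * a - 1) = 0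
    rw [map_sub, map_mul, hba, map_one, sub_self]

lemma one_notMem_C : (1 : tI1 K) ∉ C K := one_notMem_compact

lemma isCoatom_C : IsCoatom (C K) := by
  refine ⟨fun h => one_notMem_C (h ▸ Submodule.mem_top), fun I hI => ?_⟩
  obtain ⟨a, ha, hac⟩ := SetLike.exists_of_lt hI
  obtain ⟨b, -, hba⟩ := exists_inv_mod_C hac
  rw [Ideal.eq_top_iff_one, ← sub_sub_cancel (b * a) 1]
  exact sub_mem (I.mul_mem_left b ha) (hI.le hba)

lemma isCoatom_Cright : IsCoatom (Cright K) := by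
  refine ⟨fun h => one_notMem_C (show (1 : tI1 K) ∈ Cright K from h ▸ Submodule.mem_top),
    fun I hI => ?_⟩
  obtain ⟨a, ha, hac⟩ := SetLike.exists_of_lt hI
  obtain ⟨b, hab, -⟩ := exists_inv_mod_C (show a ∉ C K from hac)
  refine eq_top_iff.2 fun x _ => ?_
  have h1 : (1 : tI1 K) ∈ I := by
    rw [← sub_sub_cancel (a * b) 1]
    exact sub_mem (I.smul_mem (op b) ha) (hI.le hab)
  simpa using I.smul_mem (op x) h1

/-- Multiplying by matrix units on both sides isolates one entry; c is a nonzero entry of a, in row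
i and column n. -/
lemma exists_e_mul_mul_e {a : Module.End K (Pol K)} (ha : a ≠ 0) : ∃ i n : ℕ, ∃ c : K, c ≠ 0 ∧
    ∀ k l, e K k i * a * e K n l = c • e K k l := by
  obtain ⟨n, hn⟩ : ∃ n, a (divPow K n) ≠ 0 := by
    by_contra! h
    exact ha ((divPow K).ext h)
  obtain ⟨i, hi⟩ : ∃ i, (divPow K).repr (a (divPow K n)) i ≠ 0 := by
    by_contra! h
    exact hn ((divPow K).repr.map_eq_zero_iff.1 (Finsupp.ext h))
  refine ⟨i, n, _, hi, fun k l => ?_⟩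
  rw [mul_assoc, mul_e, mul_col, e_eq_col k i, col_apply, e_eq_col k l]
  exact LinearMap.ext fun v => smul_comm _ _ _

lemma C_le_of_ne_bot {J : Ideal (tI1 K)} [J.IsTwoSided] (hJ : J ≠ ⊥) : C K ≤ J := by
  obtain ⟨a, ha, ha0⟩ := Submodule.exists_mem_ne_zero_of_ne_bot hJ
  obtain ⟨i, n, c, hc, h⟩ := exists_e_mul_mul_e (a := (a : Module.End K (Pol K)))
    fun h => ha0 (Subtype.ext h)
  intro x hx
  obtain ⟨f, hf, u, rfl⟩ := exists_of_mem_C hx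
  refine J.mul_mem_right _ (F_subset_of_E_mem (W := J.restrictScalars K) (fun k l => ?_) hf)
  have : E K k l = algebraMap K (tI1 K) c⁻¹ * (E K k i * a * E K n l) := by
    apply Subtype.ext
    change e K k l = algebraMap K (Module.End K (Pol K)) c⁻¹ * (e K k i * a * e K n l)
    rw [h, ← Algebra.smul_def, smul_smul, inv_mul_cancel₀ hc, one_smul]
  rw [this]
  exact J.mul_mem_left _ (J.mul_mem_right _ (J.mul_mem_left _ ha))

lemma twoSided_iff_eq_C (J : Ideal (tI1 K)) (hJ : J.IsTwoSided) : J ≠ ⊥ ∧ J ≠ ⊤ ↔ J = C K := by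
  constructor
  · rintro ⟨h0, h1⟩
    by_contra h
    exact h1 (isCoatom_C.2 J (lt_of_le_of_ne (C_le_of_ne_bot h0) (Ne.symm h)))
  · rintro rfl
    refine ⟨fun h => E_ne_zero (K := K) 0 0 ?_, isCoatom_C.1⟩
    have := E_mem_C (K := K) 0 0
    rwa [h] at this

/-- A projection onto enough initial columns is a right unit for f; this makes the ideal idempotent.
-/
lemma exists_sum_E {f : tI1 K} (hf : (f : Module.End K (Pol K)) ∈ F K) :
    ∃ N, f = f * ∑ n ∈ Finset.range N, E K n n := by
  obtain ⟨N, hN⟩ := mem_F_iff.1 hf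
  refine ⟨N, Subtype.ext ((divPow K).ext fun m => ?_)⟩
  have h : ((∑ n ∈ Finset.range N, E K n n : tI1 K) : Module.End K (Pol K)) (divPow K m) =
      if m ∈ Finset.range N then divPow K m else 0 := by
    rw [AddSubmonoidClass.coe_finsetSum, LinearMap.sum_apply]
    change ∑ n ∈ Finset.range N, e K n n (divPow K m) = _
    simp_rw [e_divPow]
    rw [Finset.sum_ite_eq]
  rw [MulMemClass.coe_mul, Module.End.mul_apply, h]
  split_ifs with hm
  · rfl
  · rw [map_zero]
    exact hN m (by simpa using hm)

lemma C_mul_C : C K * C K = C K := by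
  refine le_antisymm (Ideal.mul_le.2 fun a _ b hb => Ideal.mul_mem_left _ _ hb) fun c hc => ?_
  obtain ⟨f, hf, u, rfl⟩ := exists_of_mem_C hc
  obtain ⟨N, hN⟩ := exists_sum_E hf
  rw [hN, mul_assoc]
  exact Ideal.mul_mem_mul (F_le_compact hf)
    (Ideal.mul_mem_right _ _ (sum_mem fun n _ => E_mem_C n n))

/-! ### The quotient `Ĩ₁ / 𝒞(Ĩ₁)` is the skew field of fractions of `A₁` -/

instance : Nontrivial (Pol K) := ⟨⟨_, _, (divPow K).ne_zero 0⟩⟩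

instance : NoZeroDivisors (A1 K) where
  eq_zero_or_eq_zero_of_mul_eq_zero {a b} h := by
    by_contra! hne
    exact A1_mul_ne_zero a.2 b.2 (fun h => hne.1 (Subtype.ext h))
      (fun h => hne.2 (Subtype.ext h)) (congrArg Subtype.val h)

variable (K) in
/-- The canonical homomorphism `A₁ → Ĩ₁ / 𝒞(Ĩ₁)`. -/
abbrev A1ToQuot : A1 K →ₐ[K] tI1 K ⧸ C K := (Ideal.Quotient.mkₐ K (C K)).comp (inclA1 K)

lemma coe_inclA1 (a : A1 K) : (inclA1 K a : Module.End K (Pol K)) = a :=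
  Subalgebra.coe_inclusion _ a

lemma inclA1_mem_C {a : A1 K} : inclA1 K a ∈ C K ↔ a = 0 := by
  rw [mem_C_iff, coe_inclA1, ← mem_F_iff_compact (A1_le_I1 K a.2)]
  refine ⟨fun h => ?_, fun h => ?_⟩
  · have := A1_inf_F a.2 h
    exact Subtype.ext this
  · rw [h, ZeroMemClass.coe_zero]
    exact zero_mem _

lemma A1ToQuot_apply (a : A1 K) : A1ToQuot K a = Ideal.Quotient.mk (C K) (inclA1 K a) := rfl

lemma A1ToQuot_eq_zero {a : A1 K} : A1ToQuot K a = 0 ↔ a = 0 := by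
  rw [A1ToQuot_apply, ← inclA1_mem_C]
  exact Ideal.Quotient.eq_zero_iff_mem

lemma isUnit_of_ne_zero {q : tI1 K ⧸ C K} (hq : q ≠ 0) : IsUnit q := by
  obtain ⟨a, rfl⟩ := Ideal.Quotient.mk_surjective q
  obtain ⟨b, hab, hba⟩ := exists_inv_mod_C
    (fun h => hq (Ideal.Quotient.eq_zero_iff_mem.2 h) : a ∉ C K)
  refine ⟨⟨_, Ideal.Quotient.mk (C K) b, ?_, ?_⟩, rfl⟩
  · rw [← map_mul, ← sub_eq_zero, ← map_one (Ideal.Quotient.mk (C K)), ← map_sub]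
    exact Ideal.Quotient.eq_zero_iff_mem.2 hab
  · rw [← map_mul, ← sub_eq_zero, ← map_one (Ideal.Quotient.mk (C K)), ← map_sub]
    exact Ideal.Quotient.eq_zero_iff_mem.2 hba

lemma isUnit_A1ToQuot {a : A1 K} (ha : a ≠ 0) : IsUnit (A1ToQuot K a) :=
  isUnit_of_ne_zero fun h => ha (A1ToQuot_eq_zero.1 h)

/-- If q is the class of r u⁻¹ with r∂^k ≡ w and u∂^k ≡ v modulo F for a common k, then r u⁻¹ v ≡
r∂^k ≡ w. -/
lemma exists_mul_A1ToQuot (q : tI1 K ⧸ C K) :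
    ∃ w v : A1 K, v ≠ 0 ∧ q * A1ToQuot K v = A1ToQuot K w := by
  obtain ⟨a, rfl⟩ := Ideal.Quotient.mk_surjective q
  obtain ⟨r, hr, u, hu, ha⟩ := mem_tI1_iff.1 a.2
  obtain ⟨k, hk⟩ := exists_A1_add_F hr
  obtain ⟨l, hl⟩ := exists_A1_add_F hu
  obtain ⟨w, hw, hrw⟩ := hk (k + l) (by omega)
  obtain ⟨v, hv, huv⟩ := hl (k + l) (by omega)
  refine ⟨⟨w, hw⟩, ⟨v, hv⟩, fun h => ne_zero_of_sub_mem_F (u.isUnit.map (modC K)) huv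
    (congrArg Subtype.val h), ?_⟩
  rw [A1ToQuot_apply, A1ToQuot_apply, ← map_mul, ← sub_eq_zero, ← map_sub]
  refine Ideal.Quotient.eq_zero_iff_mem.2 (F_le_compact ?_)
  rw [Subalgebra.coe_val, AddSubgroupClass.coe_sub, MulMemClass.coe_mul, coe_inclA1, coe_inclA1]
  have : (a : Module.End K (Pol K)) * v - w =
      (r * opD K ^ (k + l) - w) - a * (u * opD K ^ (k + l) - v) := by
    rw [mul_sub, ← mul_assoc, ha, Units.inv_mul_cancel_right]
    abel
  rw [this]
  exact sub_mem hrw (mul_mem_F _ huv)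

lemma isFrac_A1ToQuot : IsFrac (A1ToQuot K).toRingHom := by
  constructor
  · constructor
    · exact fun s hs => isUnit_A1ToQuot (nonZeroDivisors.ne_zero hs)
    · intro q
      obtain ⟨w, v, hv, h⟩ := exists_mul_A1ToQuot q
      -- Right fractions become left ones: tw = bv turns w v⁻¹ into t⁻¹ b.
      obtain ⟨t, ht, ht0, b, hb, htb⟩ := A1_leftOre w.2 v.2 fun h => hv (Subtype.ext h)
      have ht0' : (⟨t, ht⟩ : A1 K) ≠ 0 := fun h => ht0 (congrArg Subtype.val h)
      obtain ⟨y, hy⟩ := isUnit_A1ToQuot ht0'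
      refine ⟨⟨b, hb⟩, ⟨t, ht⟩, mem_nonZeroDivisors_iff_ne_zero.2 ht0', y, hy, ?_⟩
      rw [Units.eq_inv_mul_iff_mul_eq, hy]
      refine (isUnit_A1ToQuot hv).mul_right_cancel ?_
      rw [mul_assoc, h, ← map_mul]
      refine Eq.trans ?_ (map_mul (A1ToQuot K) ⟨b, hb⟩ v)
      exact congrArg _ (Subtype.ext htb)
    · intro r
      refine ⟨fun h => ⟨1, one_mem _, by rw [one_mul]; exact A1ToQuot_eq_zero.1 h⟩, ?_⟩
      rintro ⟨s, hs, h⟩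
      exact A1ToQuot_eq_zero.2 ((mul_eq_zero.1 h).resolve_left (nonZeroDivisors.ne_zero hs))
  · constructor
    · exact fun s hs => isUnit_A1ToQuot (nonZeroDivisors.ne_zero hs)
    · intro q
      obtain ⟨w, v, hv, h⟩ := exists_mul_A1ToQuot q
      obtain ⟨y, hy⟩ := isUnit_A1ToQuot hv
      refine ⟨w, v, mem_nonZeroDivisors_iff_ne_zero.2 hv, y, hy, ?_⟩
      rw [Units.eq_mul_inv_iff_mul_eq, hy]
      exact h
    · intro r
      refine ⟨fun h => ⟨1, one_mem _, by rw [mul_one]; exact A1ToQuot_eq_zero.1 h⟩, ?_⟩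
      rintro ⟨s, hs, h⟩
      exact A1ToQuot_eq_zero.2 ((mul_eq_zero.1 h).resolve_right (nonZeroDivisors.ne_zero hs))

/-! ### The algebra `frac_V` -/

lemma imageModCompact_mem_fracCandidates : imageModCompact (tI1 K) ∈ fracCandidates (tI1 K) := by
  refine ⟨?_, le_rfl, ?_⟩
  · rintro _ ⟨a, ha, rfl⟩
    by_cases hc : a ∈ compactIdeal K (Pol K)
    · exact Or.inl (modC_eq_zero.2 hc)
    · exact Or.inr ⟨a, isFredholmMap_of_notMem_compact ha hc, rfl⟩
  · rintro u ⟨a, ha, hau⟩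
    have hau' : modC K a = u := hau
    have hc : a ∉ compactIdeal K (Pol K) := fun h => by
      rw [← modC_eq_zero, hau'] at h
      exact u.ne_zero h
    obtain ⟨b, hb, hab, -⟩ := exists_inv_modC ha hc
    rw [hau'] at hab
    rw [Units.inv_eq_of_mul_eq_one_right hab]
    exact ⟨b, hb, rfl⟩

/-- The image already contains the inverses of its nonzero elements, so it is the least candidate.
-/
lemma fracV_eq : fracV (tI1 K) = imageModCompact (tI1 K) :=
  le_antisymm (sInf_le imageModCompact_mem_fracCandidates) (le_sInf fun _ hB => hB.2.1)

variable (K) in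
/-- The canonical homomorphism `Ĩ₁ → frac_{K[x]}(Ĩ₁)`. -/
def toFracV : tI1 K →ₐ[K] fracV (tI1 K) :=
  ((Ideal.Quotient.mkₐ K (compactIdeal K (Pol K))).comp (tI1 K).val).codRestrict (fracV (tI1 K))
    fun a => by rw [fracV_eq]; exact ⟨a, a.2, rfl⟩

lemma toFracV_coe (a : tI1 K) : (toFracV K a : OperatorsModCompact K (Pol K)) = modC K a := rfl

lemma toFracV_eq_zero {a : tI1 K} : toFracV K a = 0 ↔ a ∈ C K := by
  rw [mem_C_iff, ← modC_eq_zero, ← toFracV_coe, ZeroMemClass.coe_eq_zero]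

lemma exists_algEquiv_fracV : ∃ f : (tI1 K ⧸ C K) ≃ₐ[K] fracV (tI1 K),
    ∀ a : tI1 K, (f (Ideal.Quotient.mk (C K) a) : OperatorsModCompact K (Pol K)) =
      Ideal.Quotient.mk (compactIdeal K (Pol K)) (a : Module.End K (Pol K)) := by
  refine ⟨AlgEquiv.ofBijective (Ideal.Quotient.liftₐ (C K) (toFracV K)
    fun a ha => toFracV_eq_zero.2 ha) ⟨?_, ?_⟩, fun a => rfl⟩
  · refine (injective_iff_map_eq_zero _).2 fun q hq => ?_
    obtain ⟨a, rfl⟩ := Ideal.Quotient.mk_surjective q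
    exact Ideal.Quotient.eq_zero_iff_mem.2 (toFracV_eq_zero.1 hq)
  · rintro ⟨b, hb⟩
    have hb' := hb
    rw [fracV_eq] at hb'
    obtain ⟨a, ha, rfl⟩ := hb'
    exact ⟨Ideal.Quotient.mk (C K) ⟨a, ha⟩, rfl⟩

/-! ### Simple left modules -/

lemma smul_pol (a : tI1 K) (v : Pol K) : a • v = (a : Module.End K (Pol K)) v := rfl

variable (K) in
/-- The operator `col n v` as an element of `Ĩ₁`. -/
def colT (n : ℕ) (v : Pol K) : tI1 K := ⟨col n v, F_le_tI1 (Ecol_le_F n (col_mem_Ecol n v))⟩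

lemma colT_divPow (n i : ℕ) : colT K n (divPow K i) = E K i n := Subtype.ext (e_eq_col i n).symm

variable (K) in
/-- `v ↦ col n v` is a homomorphism of left modules. -/
def colHom (n : ℕ) : Pol K →ₗ[tI1 K] tI1 K where
  toFun := colT K n
  map_add' v w := Subtype.ext (LinearMap.ext fun _ => smul_add _ v w)
  map_smul' a v := Subtype.ext (mul_col (a : Module.End K (Pol K)) n v).symm

/-- Rank-one operators supported on one basis index send any vector with a nonzero coordinate there
to any prescribed vector. -/
instance isSimpleModule_pol : IsSimpleModule (tI1 K) (Pol K) := by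
  refine isSimpleModule_iff_toSpanSingleton_surjective.2 ⟨inferInstance, fun v hv w => ?_⟩
  obtain ⟨i, hi⟩ : ∃ i, (divPow K).repr v i ≠ 0 := by
    by_contra! h
    exact hv ((divPow K).repr.map_eq_zero_iff.1 (Finsupp.ext h))
  refine ⟨colT K i (((divPow K).repr v i)⁻¹ • w), ?_⟩
  rw [LinearMap.toSpanSingleton_apply, smul_pol]
  change (divPow K).repr v i • ((divPow K).repr v i)⁻¹ • w = w
  rw [smul_smul, mul_inv_cancel₀ hi, one_smul]

instance isSimpleModule_quot : IsSimpleModule (tI1 K) (tI1 K ⧸ C K) :=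
  isSimpleModule_iff_isCoatom.2 isCoatom_C

lemma faithfulSMul_pol : FaithfulSMul (tI1 K) (Pol K) :=
  ⟨fun h => Subtype.ext (LinearMap.ext h)⟩

lemma C_smul_quot {c : tI1 K} (hc : c ∈ C K) (q : tI1 K ⧸ C K) : c • q = 0 := by
  obtain ⟨a, rfl⟩ := Submodule.Quotient.mk_surjective _ q
  rw [← Submodule.Quotient.mk_smul, Submodule.Quotient.mk_eq_zero]
  exact Ideal.mul_mem_right _ _ hc

lemma not_faithfulSMul_quot : ¬ FaithfulSMul (tI1 K) (tI1 K ⧸ C K) := fun h =>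
  E_ne_zero (K := K) 0 0 (h.eq_of_smul_eq_smul fun q => by
    rw [C_smul_quot (E_mem_C 0 0), zero_smul])

lemma isEmpty_linearEquiv_of_smul {R : Type*} [Ring R] {M N : Type*} [AddCommGroup M]
    [Module R M] [AddCommGroup N] [Module R N] {c : R} {m : M} (hm : c • m ≠ 0)
    (hN : ∀ n : N, c • n = 0) : IsEmpty (M ≃ₗ[R] N) :=
  ⟨fun g => hm (g.map_eq_zero_iff.1 (by rw [map_smul, hN]))⟩

lemma isEmpty_pol_equiv_quot : IsEmpty (Pol K ≃ₗ[tI1 K] (tI1 K ⧸ C K)) :=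
  isEmpty_linearEquiv_of_smul (c := E K 0 0) (m := divPow K 0)
    (fun h => (divPow K).ne_zero 0 ((e_divPow_self 0 0).symm.trans h)) (C_smul_quot (E_mem_C 0 0))

lemma nonempty_equiv_of_apply_ne_zero {R : Type*} [Ring R] {M N : Type*} [AddCommGroup M]
    [Module R M] [AddCommGroup N] [Module R N] [IsSimpleModule R M] [IsSimpleModule R N]
    (f : N →ₗ[R] M) {n : N} (hn : f n ≠ 0) : Nonempty (M ≃ₗ[R] N) :=
  ⟨(LinearEquiv.ofBijective f (LinearMap.bijective_of_ne_zero
    fun h => hn (by rw [h, LinearMap.zero_apply]))).symm⟩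

lemma nonempty_equiv_quotient {R : Type*} [Ring R] {M N : Type*} [AddCommGroup M]
    [Module R M] [AddCommGroup N] [Module R N] [IsSimpleModule R M] {D : Submodule R N}
    (hD : IsCoatom D) (f : N →ₗ[R] M) (hf : D ≤ LinearMap.ker f) {n : N} (hn : f n ≠ 0) :
    Nonempty (M ≃ₗ[R] N ⧸ D) := by
  have : IsSimpleModule R (N ⧸ D) := isSimpleModule_iff_isCoatom.2 hD
  exact nonempty_equiv_of_apply_ne_zero (D.liftQ f hf) (n := Submodule.Quotient.mk n)
    (by rwa [Submodule.liftQ_apply])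

/-- If all matrix units kill M, so does the ideal 𝒞, and M is a quotient of Ĩ₁ by that maximal left
ideal. If e_ij m ≠ 0, then v ↦ `colT K j v • m` is a nonzero map from K[x]. -/
lemma simple_left_classification (M : Type v) [AddCommGroup M] [Module (tI1 K) M]
    [IsSimpleModule (tI1 K) M] :
    Nonempty (M ≃ₗ[tI1 K] Pol K) ∨ Nonempty (M ≃ₗ[tI1 K] (tI1 K ⧸ C K)) := by
  by_cases h : ∀ i j, ∀ m : M, E K i j • m = 0
  · right
    have := IsSimpleModule.nontrivial (tI1 K) M
    obtain ⟨m, hm⟩ := exists_ne (0 : M)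
    refine nonempty_equiv_quotient isCoatom_C (LinearMap.toSpanSingleton (tI1 K) M m)
      (fun c hc => ?_) (n := 1) (by rwa [LinearMap.toSpanSingleton_apply, one_smul])
    obtain ⟨f, hf, u, rfl⟩ := exists_of_mem_C hc
    rw [LinearMap.mem_ker, LinearMap.toSpanSingleton_apply, mul_smul]
    exact F_subset_of_E_mem (W := (LinearMap.ker (LinearMap.toSpanSingleton (tI1 K) M
      ((↑u⁻¹ : tI1 K) • m))).restrictScalars K) (fun i j => h i j _) hf
  · left
    push Not at h
    obtain ⟨i, j, m, hm⟩ := h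
    refine nonempty_equiv_of_apply_ne_zero
      ((LinearMap.toSpanSingleton (tI1 K) M m).comp (colHom K j)) (n := divPow K i) ?_
    change colT K j (divPow K i) • m ≠ 0
    rwa [colT_divPow]

/-! ### Direct sums of left ideals -/

variable (K) in
/-- The left ideal `E_{ℕ,i}` of `Ĩ₁`. -/
def leftE (i : ℕ) : Ideal (tI1 K) where
  carrier := {a | a * E K i i = a}
  zero_mem' := zero_mul _
  add_mem' {a b} ha hb := by
    change (a + b) * E K i i = a + b
    rw [add_mul, ha, hb]
  smul_mem' c a ha := by
    change c * a * E K i i = c * a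
    rw [mul_assoc, ha]

lemma mem_leftE {i : ℕ} {a : tI1 K} : a ∈ leftE K i ↔ a * E K i i = a := Iff.rfl

lemma mem_leftE_iff_mem_Ecol {i : ℕ} {a : tI1 K} :
    a ∈ leftE K i ↔ (a : Module.End K (Pol K)) ∈ Ecol K i := by
  rw [mem_Ecol_iff, ← mul_e, mem_leftE]
  exact ⟨fun h => (congrArg Subtype.val h).symm, fun h => Subtype.ext h.symm⟩

lemma asOps_leftE (i : ℕ) : asOps K (leftE K i : Set (tI1 K)) = Ecol K i := by
  ext a
  constructor
  · rintro ⟨b, hb, rfl⟩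
    exact mem_leftE_iff_mem_Ecol.1 hb
  · exact fun ha => ⟨⟨a, F_le_tI1 (Ecol_le_F i ha)⟩, mem_leftE_iff_mem_Ecol.2 ha, rfl⟩

lemma Ecol_eq_F_mul (i : ℕ) : (Ecol K i : Set (Module.End K (Pol K))) =
    (F K : Set (Module.End K (Pol K))) * {e K 0 i} := by
  ext a
  rw [Set.mul_singleton]
  constructor
  · intro ha
    refine ⟨a * e K i 0, ?_, ?_⟩
    · rw [mul_e]
      exact Ecol_le_F 0 (col_mem_Ecol 0 _)
    · change a * e K i 0 * e K 0 i = a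
      rw [mul_assoc, e_mul_e_self, mul_e, ← mem_Ecol_iff.1 ha]
  · rintro ⟨f, -, rfl⟩
    change f * e K 0 i ∈ Ecol K i
    rw [mul_e]
    exact col_mem_Ecol i _

lemma E_mem_leftE (j i : ℕ) : E K j i ∈ leftE K i := E_mul_E j i i

lemma leftE_ne_bot (i : ℕ) : leftE K i ≠ ⊥ := fun h => by
  have := E_mem_leftE (K := K) i i
  rw [h] at this
  exact E_ne_zero i i this

lemma colT_mem_leftE (i : ℕ) (v : Pol K) : colT K i v ∈ leftE K i :=
  mem_leftE_iff_mem_Ecol.2 (col_mem_Ecol i v)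

variable (K) in
/-- The left ideal `E_{ℕ,i}` is isomorphic to `K[x]`. -/
def leftEEquiv (i : ℕ) : leftE K i ≃ₗ[tI1 K] Pol K :=
  LinearEquiv.symm
    { (colHom K i).codRestrict (leftE K i) (colT_mem_leftE i) with
      invFun := fun a => (a : tI1 K) • divPow K i
      left_inv := fun v => by
        change col i v (divPow K i) = v
        rw [col_divPow, if_pos rfl]
      right_inv := fun a => Subtype.ext
        (Subtype.ext (mem_Ecol_iff.1 (mem_leftE_iff_mem_Ecol.1 a.2)).symm) }

/-- Right multiplication by e_ii is the identity on the i-th summand and zero on the others. -/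
lemma iSupIndep_leftE : iSupIndep (leftE K) := fun i => by
  refine Submodule.disjoint_def.2 fun a ha hb => ?_
  have h : ⨆ j ≠ i, leftE K j ≤ LinearMap.ker (LinearMap.toSpanSingleton (tI1 K) (tI1 K)
      (E K i i)) := by
    refine iSup₂_le fun j hj x hx => ?_
    rw [LinearMap.mem_ker, LinearMap.toSpanSingleton_apply, smul_eq_mul, ← mem_leftE.1 hx,
      mul_assoc]
    have : E K j j * E K i i = 0 := Subtype.ext ((e_mul_e j j i i).trans (if_neg hj))
    rw [this, mul_zero]
  exact (mem_leftE.1 ha).symm.trans (h hb)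

variable (K) in
/-- `F` as a left ideal of `Ĩ₁`. -/
def leftF : Ideal (tI1 K) where
  carrier := {a | (a : Module.End K (Pol K)) ∈ F K}
  zero_mem' := (F K).zero_mem
  add_mem' ha hb := (F K).add_mem ha hb
  smul_mem' c _ ha := mul_mem_F (c : Module.End K (Pol K)) ha

lemma iSup_leftE : ⨆ i, leftE K i = leftF K := by
  refine le_antisymm (iSup_le fun i a ha => Ecol_le_F i (mem_leftE_iff_mem_Ecol.1 ha))
    fun a ha => ?_
  exact F_subset_of_E_mem (W := (⨆ i, leftE K i).restrictScalars K)
    (fun i j => (le_iSup (leftE K) j) (E_mem_leftE i j)) ha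

lemma asOps_iSup_leftE :
    asOps K ((⨆ i, leftE K i : Ideal (tI1 K)) : Set (tI1 K)) = F K := by
  rw [iSup_leftE]
  ext a
  constructor
  · rintro ⟨b, hb, rfl⟩
    exact hb
  · exact fun ha => ⟨⟨a, F_le_tI1 ha⟩, ha, rfl⟩

lemma not_isNoetherianRing_tI1 : ¬ IsNoetherianRing (tI1 K) := fun h => by
  have : IsNoetherian (tI1 K) (tI1 K) := h
  have := WellFoundedGT.finite_of_iSupIndep (iSupIndep_leftE (K := K)) leftE_ne_bot
  exact Infinite.not_finite this

/-! ### Direct sums of right ideals -/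

variable (K) in
/-- The right ideal `e_{ii} Ĩ₁ = E_{i,ℕ} (I₁⁰)⁻¹` of `Ĩ₁`. -/
def rightE (i : ℕ) : Submodule (tI1 K)ᵐᵒᵖ (tI1 K) where
  carrier := {a | E K i i * a = a}
  zero_mem' := mul_zero _
  add_mem' {a b} ha hb := by
    change E K i i * (a + b) = a + b
    rw [mul_add, ha, hb]
  smul_mem' c a ha := by
    change E K i i * (a * c.unop) = a * c.unop
    rw [← mul_assoc, ha]

lemma mem_rightE {i : ℕ} {a : tI1 K} : a ∈ rightE K i ↔ E K i i * a = a := Iff.rfl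

lemma E_mul_mem_rightE (i j : ℕ) (a : tI1 K) : E K i j * a ∈ rightE K i := by
  rw [mem_rightE, ← mul_assoc, E_mul_E]

lemma E_mem_rightE (i j : ℕ) : E K i j ∈ rightE K i := E_mul_E i i j

lemma rightE_ne_bot (i : ℕ) : rightE K i ≠ ⊥ := fun h => by
  have := E_mem_rightE (K := K) i i
  rw [h] at this
  exact E_ne_zero i i this

lemma e_mul_mem_Erow_of_I1 (i j : ℕ) {r : Module.End K (Pol K)} (hr : r ∈ I1 K) :
    e K i j * r ∈ Erow K i := by
  rw [← e_mul_e_self i i j, mul_assoc]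
  exact e_mul_mem_Erow i i (F_mul_mem hr (e_mem_F i j))

lemma asOps_rightE (i : ℕ) : asOps K (rightE K i : Set (tI1 K)) =
    (Erow K i : Set (Module.End K (Pol K))) * I10inv K := by
  ext a
  constructor
  · rintro ⟨b, hb, rfl⟩
    obtain ⟨r, hr, u, hu, h⟩ := mem_tI1_iff.1 b.2
    refine ⟨e K i i * r, e_mul_mem_Erow_of_I1 i i hr, _, ⟨u, hu, rfl⟩, ?_⟩
    change e K i i * r * (↑u⁻¹ : Module.End K (Pol K)) = b
    rw [mul_assoc, ← h]
    exact congrArg Subtype.val hb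
  · rintro ⟨f, hf, _, ⟨u, hu, rfl⟩, rfl⟩
    refine ⟨⟨f * (↑u⁻¹ : Module.End K (Pol K)), mul_mem (F_le_tI1 (Erow_le_F i hf))
      (inv_mem_tI1 hu)⟩, Subtype.ext ?_, rfl⟩
    change e K i i * (f * (↑u⁻¹ : Module.End K (Pol K))) = _
    rw [← mul_assoc, e_mul_of_mem_Erow hf]

lemma Erow_eq_mul_F (i : ℕ) : (Erow K i : Set (Module.End K (Pol K))) =
    {e K i 0} * (F K : Set (Module.End K (Pol K))) := by
  ext a
  rw [Set.singleton_mul]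
  constructor
  · intro ha
    refine ⟨e K 0 i * a, mul_mem_F _ (Erow_le_F i ha), ?_⟩
    change e K i 0 * (e K 0 i * a) = a
    rw [← mul_assoc, e_mul_e_self, e_mul_of_mem_Erow ha]
  · rintro ⟨f, hf, rfl⟩
    exact e_mul_mem_Erow i 0 hf

lemma iSupIndep_Erow : iSupIndep (Erow K) := fun i => by
  refine Submodule.disjoint_def.2 fun a ha hb => ?_
  have h : ⨆ j ≠ i, Erow K j ≤ LinearMap.ker (LinearMap.mulLeft K (e K i i)) := by
    refine iSup₂_le fun j hj x hx => ?_
    rw [LinearMap.mem_ker, LinearMap.mulLeft_apply, ← e_mul_of_mem_Erow hx, ← mul_assoc,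
      e_mul_e, if_neg hj.symm, zero_mul]
  exact (e_mul_of_mem_Erow ha).symm.trans (h hb)

lemma iSup_Erow : ⨆ i, Erow K i = F K := by
  refine le_antisymm (iSup_le Erow_le_F) (Submodule.span_le.2 ?_)
  rintro _ ⟨p, rfl⟩
  exact (le_iSup (Erow K) p.1) (Submodule.subset_span ⟨p.2, rfl⟩)

variable (K) in
/-- Left multiplication by an element of `Ĩ₁`, as a homomorphism of right modules. -/
def mulLeftRight (a : tI1 K) : tI1 K →ₗ[(tI1 K)ᵐᵒᵖ] tI1 K where
  toFun b := a * b
  map_add' := mul_add a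
  map_smul' c b := (mul_assoc a b c.unop).symm

lemma iSupIndep_rightE : iSupIndep (rightE K) := fun i => by
  refine Submodule.disjoint_def.2 fun a ha hb => ?_
  have h : ⨆ j ≠ i, rightE K j ≤ LinearMap.ker (mulLeftRight K (E K i i)) := by
    refine iSup₂_le fun j hj x hx => ?_
    rw [LinearMap.mem_ker]
    change E K i i * x = 0
    rw [← mem_rightE.1 hx, ← mul_assoc]
    have : E K i i * E K j j = 0 := Subtype.ext ((e_mul_e i i j j).trans (if_neg hj.symm))
    rw [this, zero_mul]
  exact (mem_rightE.1 ha).symm.trans (h hb)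

/-- A right ideal of `Ĩ₁` is a subspace. -/
def subspaceOfRight (W : Submodule (tI1 K)ᵐᵒᵖ (tI1 K)) : Submodule K (tI1 K) where
  carrier := W
  zero_mem' := W.zero_mem
  add_mem' := W.add_mem
  smul_mem' c a ha := by
    rw [Algebra.smul_def, Algebra.commutes]
    exact W.smul_mem (op (algebraMap K (tI1 K) c)) ha

lemma C_subset_of_E_mem {W : Submodule (tI1 K)ᵐᵒᵖ (tI1 K)} (hW : ∀ i j, E K i j ∈ W) :
    Cright K ≤ W := fun c hc => by
  obtain ⟨f, hf, u, rfl⟩ := exists_of_mem_C hc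
  exact W.smul_mem (op (↑u⁻¹ : tI1 K)) (F_subset_of_E_mem (W := subspaceOfRight W) hW hf)

lemma iSup_rightE : ⨆ i, rightE K i = Cright K := by
  refine le_antisymm (iSup_le fun i a ha => ?_)
    (C_subset_of_E_mem fun i j => (le_iSup (rightE K) i) (E_mem_rightE i j))
  rw [← mem_rightE.1 ha]
  exact Ideal.mul_mem_right (I := C K) _ (E_mem_C i i)

lemma asOps_iSup_rightE :
    asOps K ((⨆ i, rightE K i : Submodule (tI1 K)ᵐᵒᵖ (tI1 K)) : Set (tI1 K)) = FS K := by
  rw [iSup_rightE]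
  exact asOps_C

lemma not_isNoetherianRing_op_tI1 : ¬ IsNoetherianRing (tI1 K)ᵐᵒᵖ := fun h => by
  have : IsNoetherian (tI1 K)ᵐᵒᵖ (tI1 K)ᵐᵒᵖ := h
  have : IsNoetherian (tI1 K)ᵐᵒᵖ (tI1 K) := isNoetherian_of_surjective
    (LinearMap.toSpanSingleton (tI1 K)ᵐᵒᵖ (tI1 K) 1)
    (LinearMap.range_eq_top.2 fun a => ⟨op a, one_mul a⟩)
  have := WellFoundedGT.finite_of_iSupIndep (iSupIndep_rightE (K := K)) rightE_ne_bot
  exact Infinite.not_finite this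

/-! ### Simple right modules -/

/-- A nonzero a has only row 0; if its n-th entry is c ≠ 0, then a·c⁻¹e_{n0} = e_00, which
generates. -/
instance isSimpleModule_rightE : IsSimpleModule (tI1 K)ᵐᵒᵖ (rightE K 0) := by
  refine isSimpleModule_iff_toSpanSingleton_surjective.2
    ⟨⟨⟨⟨_, E_mem_rightE 0 0⟩, 0, fun h => E_ne_zero 0 0 (congrArg Subtype.val h)⟩⟩, ?_⟩
  rintro ⟨a, ha⟩ ha0 ⟨b, hb⟩
  obtain ⟨i, n, c, hc, h⟩ := exists_e_mul_mul_e (a := (a : Module.End K (Pol K)))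
    fun h => ha0 (Subtype.ext (Subtype.ext h))
  have hi : i = 0 := by
    by_contra hi
    have h0 := h 0 0
    have ha' : e K 0 0 * (a : Module.End K (Pol K)) = a := congrArg Subtype.val ha
    rw [← ha', ← mul_assoc, e_mul_e, if_neg hi, zero_mul, zero_mul] at h0
    exact (smul_ne_zero hc (e_ne_zero 0 0)) h0.symm
  subst hi
  refine ⟨op (algebraMap K (tI1 K) c⁻¹ * E K n 0 * b), Subtype.ext ?_⟩
  change a * (algebraMap K (tI1 K) c⁻¹ * E K n 0 * b) = b
  have key : a * (algebraMap K (tI1 K) c⁻¹ * E K n 0) = E K 0 0 := by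
    rw [← mul_assoc, ← Algebra.commutes, mul_assoc, ← Algebra.smul_def]
    conv_lhs => rw [← mem_rightE.1 ha]
    have h1 : E K 0 0 * a * E K n 0 = c • E K 0 0 := Subtype.ext (h 0 0)
    rw [h1, smul_smul, inv_mul_cancel₀ hc, one_smul]
  rw [← mul_assoc, key]
  exact hb

instance isSimpleModule_quot_right : IsSimpleModule (tI1 K)ᵐᵒᵖ (tI1 K ⧸ Cright K) :=
  isSimpleModule_iff_isCoatom.2 isCoatom_Cright

lemma eq_of_e_mul_eq {a b : tI1 K} (h : ∀ i, E K 0 i * a = E K 0 i * b) : a = b := by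
  refine Subtype.ext (LinearMap.ext fun v => (divPow K).ext_elem fun i => ?_)
  have h1 : (e K 0 i * (a : Module.End K (Pol K))) v = (e K 0 i * (b : Module.End K (Pol K))) v :=
    LinearMap.congr_fun (congrArg Subtype.val (h i)) v
  rw [Module.End.mul_apply, Module.End.mul_apply, e_eq_col, col_apply, col_apply] at h1
  exact smul_left_injective K ((divPow K).ne_zero 0) h1

lemma faithfulSMul_rightE : FaithfulSMul (tI1 K)ᵐᵒᵖ (rightE K 0) := ⟨fun h =>
  unop_injective (eq_of_e_mul_eq fun i =>
    congrArg Subtype.val (h ⟨E K 0 i, E_mem_rightE 0 i⟩))⟩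

lemma C_smul_quot_right {c : tI1 K} (hc : c ∈ C K) (q : tI1 K ⧸ Cright K) : op c • q = 0 := by
  obtain ⟨a, rfl⟩ := Submodule.Quotient.mk_surjective _ q
  rw [← Submodule.Quotient.mk_smul, Submodule.Quotient.mk_eq_zero]
  exact Ideal.mul_mem_left (C K) a hc

lemma not_faithfulSMul_quot_right : ¬ FaithfulSMul (tI1 K)ᵐᵒᵖ (tI1 K ⧸ Cright K) := fun h =>
  E_ne_zero (K := K) 0 0 (op_injective (h.eq_of_smul_eq_smul fun q => by
    rw [C_smul_quot_right (E_mem_C 0 0), op_zero, zero_smul]))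

lemma isEmpty_rightE_equiv_quot :
    IsEmpty (rightE K 0 ≃ₗ[(tI1 K)ᵐᵒᵖ] (tI1 K ⧸ Cright K)) :=
  isEmpty_linearEquiv_of_smul (c := op (E K 0 0)) (m := ⟨E K 0 0, E_mem_rightE 0 0⟩)
    (fun h => E_ne_zero (K := K) 0 0 ((E_mul_E 0 0 0).symm.trans (congrArg Subtype.val h)))
    (C_smul_quot_right (E_mem_C 0 0))

/-- For an element `m` of a right `Ĩ₁`-module, the homomorphism `a ↦ m a`. -/
def rightSpan {M : Type v} [AddCommGroup M] [Module (tI1 K)ᵐᵒᵖ M] (m : M) :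
    tI1 K →ₗ[(tI1 K)ᵐᵒᵖ] M where
  toFun a := op a • m
  map_add' a b := by rw [op_add, add_smul]
  map_smul' c a := by
    rw [RingHom.id_apply, smul_smul]
    rfl

/-- As on the left, with m e_ij ≠ 0 factored as (m e_i0) e_0j to get a nonzero map from e_00 Ĩ₁. -/
lemma simple_right_classification (M : Type w) [AddCommGroup M] [Module (tI1 K)ᵐᵒᵖ M]
    [IsSimpleModule (tI1 K)ᵐᵒᵖ M] :
    Nonempty (M ≃ₗ[(tI1 K)ᵐᵒᵖ] rightE K 0) ∨
      Nonempty (M ≃ₗ[(tI1 K)ᵐᵒᵖ] (tI1 K ⧸ Cright K)) := by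
  by_cases h : ∀ i j, ∀ m : M, op (E K i j) • m = 0
  · right
    have := IsSimpleModule.nontrivial (tI1 K)ᵐᵒᵖ M
    obtain ⟨m, hm⟩ := exists_ne (0 : M)
    exact nonempty_equiv_quotient isCoatom_Cright (rightSpan m)
      (C_subset_of_E_mem fun i j => h i j m) (n := 1) (by
        change op (1 : tI1 K) • m ≠ 0
        rwa [op_one, one_smul])
  · left
    push Not at h
    obtain ⟨i, j, m, hm⟩ := h
    refine nonempty_equiv_of_apply_ne_zero (N := rightE K 0) ((rightSpan (op (E K i 0) • m)).comp
      (rightE K 0).subtype) (n := ⟨E K 0 j, E_mem_rightE 0 j⟩) ?_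
    change op (E K 0 j) • op (E K i 0) • m ≠ 0
    rwa [smul_smul, ← op_mul, E_mul_E]

/-! ### The right module `I₁ / ∫ I₁` and its localization -/

lemma eq_opInt_mul_add (a : Module.End K (Pol K)) :
    a = opInt K * (opD K * a) + e K 0 0 * a := by
  rw [← mul_assoc, opInt_mul_opD, sub_mul, one_mul, sub_add_cancel]

/-- From e_00 ∫ = 0 and a = ∫∂a + e_00 a. Thus I₁/∫I₁ is e_00 I₁, which sits inside e_00 Ĩ₁. -/
lemma mem_intIdeal_iff {a : I1 K} : a ∈ intIdeal K ↔ e K 0 0 * (a : Module.End K (Pol K)) = 0 := by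
  constructor
  · intro ha
    obtain ⟨b, rfl⟩ := Submodule.mem_span_singleton.1 ha
    change e K 0 0 * (opInt K * (b.unop : Module.End K (Pol K))) = 0
    rw [← mul_assoc, e_mul_opInt, zero_mul]
  · intro ha
    refine Submodule.mem_span_singleton.2 ⟨op (dI1 K * a), Subtype.ext ?_⟩
    have h := eq_opInt_mul_add (a : Module.End K (Pol K))
    rw [ha, add_zero] at h
    exact h.symm

lemma coe_aeval_dI1 (p : K[X]) :
    (aeval (dI1 K) p : Module.End K (Pol K)) = aeval (opD K) p :=
  (Polynomial.aeval_algHom_apply (I1 K).val (dI1 K) p).symm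

lemma e_mul_opD_pow (j : ℕ) : e K 0 0 * opD K ^ j = e K 0 j := by
  rw [e, pow_zero, pow_zero, e, sub_mul, one_mul, one_mul, mul_assoc, zero_add, pow_one, ← pow_add,
    add_comm 1 j]
  simp

lemma e_mul_aeval_apply (p : K[X]) (j : ℕ) :
    (e K 0 0 * aeval (opD K) p) (divPow K j) = p.coeff j • divPow K 0 := by
  induction p using Polynomial.induction_on' with
  | add p q hp hq =>
    rw [map_add, mul_add, LinearMap.add_apply, hp, hq, Polynomial.coeff_add, add_smul]
  | monomial n c =>
    rw [Polynomial.aeval_monomial, ← Algebra.smul_def, mul_smul_comm, e_mul_opD_pow,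
      LinearMap.smul_apply, e_divPow, Polynomial.coeff_monomial]
    rcases eq_or_ne n j with rfl | h
    · rw [if_pos rfl, if_pos rfl]
    · rw [if_neg h.symm, if_neg h, smul_zero, zero_smul]

lemma exists_e_mul_aeval_eq {f : Module.End K (Pol K)} (hf : f ∈ Erow K 0) :
    ∃ p : K[X], e K 0 0 * aeval (opD K) p = f := by
  have h : Erow K 0 ≤ LinearMap.range ((LinearMap.mulLeft K (e K 0 0)).comp
      (aeval (R := K) (opD K)).toLinearMap) := by
    refine Submodule.span_le.2 ?_
    rintro _ ⟨j, rfl⟩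
    refine ⟨X ^ j, ?_⟩
    change e K 0 0 * aeval (opD K) (X ^ j) = _
    rw [map_pow, aeval_X, e_mul_opD_pow]
  exact h hf

/-- Under a ↦ e_00 a, the class of p(∂) becomes the row of coefficients of p, and every finite row
arises. -/
lemma bijective_mk_aeval : Function.Bijective (fun p : K[X] =>
    (Submodule.Quotient.mk (aeval (dI1 K) p) : I1 K ⧸ intIdeal K)) := by
  constructor
  · intro p q h
    have h1 := mem_intIdeal_iff.1 ((Submodule.Quotient.eq _).1 h)
    rw [← map_sub, coe_aeval_dI1] at h1
    refine sub_eq_zero.1 (Polynomial.ext fun j => ?_)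
    have h2 := e_mul_aeval_apply (p - q) j
    rw [h1, LinearMap.zero_apply] at h2
    rw [Polynomial.coeff_zero]
    exact (smul_eq_zero.1 h2.symm).resolve_right ((divPow K).ne_zero 0)
  · intro x
    obtain ⟨a, rfl⟩ := Submodule.Quotient.mk_surjective _ x
    obtain ⟨p, hp⟩ := exists_e_mul_aeval_eq (e_mul_mem_Erow_of_I1 0 0 a.2)
    refine ⟨p, (Submodule.Quotient.eq _).2 (mem_intIdeal_iff.2 ?_)⟩
    rw [AddSubgroupClass.coe_sub, mul_sub, coe_aeval_dI1, hp, sub_self]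

variable (K) in
/-- The map `I₁ → e₀₀ Ĩ₁`, `a ↦ e₀₀ a`. -/
def toRightE : I1 K →ₛₗ[(inclI1 K).toRingHom.op] rightE K 0 where
  toFun a := ⟨E K 0 0 * inclI1 K a, E_mul_mem_rightE 0 0 _⟩
  map_add' a b := Subtype.ext (by
    change E K 0 0 * inclI1 K (a + b) = E K 0 0 * inclI1 K a + E K 0 0 * inclI1 K b
    rw [map_add, mul_add])
  map_smul' c a := Subtype.ext (by
    change E K 0 0 * inclI1 K (a * c.unop) = E K 0 0 * inclI1 K a * inclI1 K c.unop
    rw [map_mul, mul_assoc])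

lemma coe_toRightE (a : I1 K) :
    ((toRightE K a : tI1 K) : Module.End K (Pol K)) = e K 0 0 * a := by
  change e K 0 0 * (inclI1 K a : Module.End K (Pol K)) = _
  rw [coe_inclI1]

lemma toRightE_eq_zero {a : I1 K} : toRightE K a = 0 ↔ a ∈ intIdeal K := by
  rw [mem_intIdeal_iff, ← coe_toRightE, ZeroMemClass.coe_eq_zero, ZeroMemClass.coe_eq_zero]

variable (K) in
/-- The localization map `I₁ / ∫ I₁ → e₀₀ Ĩ₁`, as a semilinear map. -/
def quotToRightEHom : (I1 K ⧸ intIdeal K) →ₛₗ[(inclI1 K).toRingHom.op] rightE K 0 :=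
  Submodule.liftQ (R₂ := (tI1 K)ᵐᵒᵖ) (M₂ := rightE K 0) (τ₁₂ := (inclI1 K).toRingHom.op)
    (intIdeal K) (toRightE K) fun _ ha => LinearMap.mem_ker.2 (toRightE_eq_zero.2 ha)

variable (K) in
/-- The localization map `I₁ / ∫ I₁ → e₀₀ Ĩ₁`. -/
def quotToRightE : (I1 K ⧸ intIdeal K) →+ rightE K 0 := (quotToRightEHom K).toAddMonoidHom

lemma quotToRightE_mk (a : I1 K) : quotToRightE K (Submodule.Quotient.mk a) = toRightE K a := rfl

/-- The map a ↦ e_00 a is injective on the quotient, and elements of I₁⁰ are invertible operators,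
so there is no torsion; denominators come from writing elements of Ĩ₁ as fractions. -/
lemma isRightModuleLocalization_quotToRightE :
    IsRightModuleLocalization (I10 K) (inclI1 K).toRingHom (quotToRightE K) where
  map_smul r m := (quotToRightEHom K).map_smulₛₗ (op r) m
  exists_frac := by
    rintro ⟨a, ha⟩
    obtain ⟨r, s, hs, u, hu, h⟩ := exists_frac_tI1 a
    refine ⟨Submodule.Quotient.mk r, s, hs, u, hu, Subtype.ext ?_⟩
    change a = E K 0 0 * inclI1 K r * (↑u⁻¹ : tI1 K)
    rw [mul_assoc, ← h]
    exact ha.symm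
  ker m := by
    obtain ⟨a, rfl⟩ := Submodule.Quotient.mk_surjective _ m
    constructor
    · intro h
      refine ⟨1, one_mem _, ?_⟩
      rw [op_one, one_smul, Submodule.Quotient.mk_eq_zero, ← toRightE_eq_zero, ← quotToRightE_mk]
      exact h
    · rintro ⟨s, hs, h⟩
      rw [← Submodule.Quotient.mk_smul, Submodule.Quotient.mk_eq_zero, mem_intIdeal_iff] at h
      obtain ⟨u, hu⟩ := mem_I10_iff.1 hs
      rw [quotToRightE_mk]
      refine toRightE_eq_zero.2 (mem_intIdeal_iff.2 ((Units.mul_left_eq_zero u).1 ?_))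
      rw [hu, mul_assoc]
      exact h

end IntDiff
end

theorem theorem7 (K : Type u) [Field K] [CharZero K] :
    -- products of `F` with inverses
    (IntDiff.I10inv K * (IntDiff.F K : Set (Module.End K (IntDiff.Pol K))) = IntDiff.F K ∧
      (IntDiff.F K : Set (Module.End K (IntDiff.Pol K))) ⊂ IntDiff.FS K) ∧
    -- Ore conditions and the right quotient ring
    (IsRightOreSet (IntDiff.I10 K) ∧ ¬ IsLeftOreSet (IntDiff.I10 K) ∧
      IsRightQuotientRing (IntDiff.I10 K) (IntDiff.inclI1 K).toRingHom) ∧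
    -- the only proper ideal `J = F (I₁⁰)⁻¹`
    (∃ J : Ideal (IntDiff.tI1 K), ∃ _ : J.IsTwoSided,
      IntDiff.asOps K J = IntDiff.FS K ∧
      (∀ J' : Ideal (IntDiff.tI1 K), J'.IsTwoSided → (J' ≠ ⊥ ∧ J' ≠ ⊤ ↔ J' = J)) ∧
      J * J = J ∧
      IsFrac (((Ideal.Quotient.mkₐ K J).comp (IntDiff.inclA1 K)).toRingHom) ∧
      IntDiff.C K = J) ∧
    -- the algebra `frac_V` for `V = K[x]`
    ((∀ a ∈ IntDiff.tI1 K, a ∉ compactIdeal K (IntDiff.Pol K) → IsFredholmMap a) ∧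
      (fracCandidates (IntDiff.tI1 K)).Nonempty ∧
      (∃ f : (IntDiff.tI1 K ⧸ IntDiff.C K) ≃ₐ[K] fracV (IntDiff.tI1 K),
        ∀ a : IntDiff.tI1 K, (f (Ideal.Quotient.mk (IntDiff.C K) a) : OperatorsModCompact K (IntDiff.Pol K)) =
          Ideal.Quotient.mk (compactIdeal K (IntDiff.Pol K)) (a : Module.End K (IntDiff.Pol K))) ∧
      IsFrac (((Ideal.Quotient.mkₐ K (IntDiff.C K)).comp (IntDiff.inclA1 K)).toRingHom)) ∧
    -- simple left modules
    (IsSimpleModule (IntDiff.tI1 K) (IntDiff.Pol K) ∧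
      IsSimpleModule (IntDiff.tI1 K) (IntDiff.tI1 K ⧸ IntDiff.C K) ∧
      FaithfulSMul (IntDiff.tI1 K) (IntDiff.Pol K) ∧
      ¬ FaithfulSMul (IntDiff.tI1 K) (IntDiff.tI1 K ⧸ IntDiff.C K) ∧
      IsEmpty (IntDiff.Pol K ≃ₗ[IntDiff.tI1 K] (IntDiff.tI1 K ⧸ IntDiff.C K)) ∧
      ∀ (M : Type v) [AddCommGroup M] [Module (IntDiff.tI1 K) M],
        IsSimpleModule (IntDiff.tI1 K) M →
          Nonempty (M ≃ₗ[IntDiff.tI1 K] (IntDiff.Pol K)) ∨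
          Nonempty (M ≃ₗ[IntDiff.tI1 K] (IntDiff.tI1 K ⧸ IntDiff.C K))) ∧
    -- simple right modules
    (Function.Bijective (fun p : K[X] =>
        (Submodule.Quotient.mk (aeval (IntDiff.dI1 K) p) : IntDiff.I1 K ⧸ IntDiff.intIdeal K)) ∧
      ∃ (N : Type u) (_ : AddCommGroup N) (_ : Module (IntDiff.tI1 K)ᵐᵒᵖ N)
        (φ : (IntDiff.I1 K ⧸ IntDiff.intIdeal K) →+ N),
        IsRightModuleLocalization (IntDiff.I10 K) (IntDiff.inclI1 K).toRingHom φ ∧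
        IsSimpleModule (IntDiff.tI1 K)ᵐᵒᵖ N ∧
        IsSimpleModule (IntDiff.tI1 K)ᵐᵒᵖ (IntDiff.tI1 K ⧸ IntDiff.Cright K) ∧
        FaithfulSMul (IntDiff.tI1 K)ᵐᵒᵖ N ∧
        ¬ FaithfulSMul (IntDiff.tI1 K)ᵐᵒᵖ (IntDiff.tI1 K ⧸ IntDiff.Cright K) ∧
        IsEmpty (N ≃ₗ[(IntDiff.tI1 K)ᵐᵒᵖ] (IntDiff.tI1 K ⧸ IntDiff.Cright K)) ∧
        ∀ (M : Type w) [AddCommGroup M] [Module (IntDiff.tI1 K)ᵐᵒᵖ M],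
          IsSimpleModule (IntDiff.tI1 K)ᵐᵒᵖ M →
            Nonempty (M ≃ₗ[(IntDiff.tI1 K)ᵐᵒᵖ] N) ∨
            Nonempty (M ≃ₗ[(IntDiff.tI1 K)ᵐᵒᵖ] (IntDiff.tI1 K ⧸ IntDiff.Cright K))) ∧
    -- direct sums of left ideals
    ((∃ L : ℕ → Ideal (IntDiff.tI1 K),
        (∀ i, IntDiff.asOps K (L i) = IntDiff.Ecol K i) ∧
        (∀ i, (IntDiff.Ecol K i : Set (Module.End K (IntDiff.Pol K))) =
          (IntDiff.F K : Set (Module.End K (IntDiff.Pol K))) * {IntDiff.e K 0 i}) ∧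
        (∀ i, L i ≠ ⊥) ∧
        (∀ i, Nonempty (L i ≃ₗ[IntDiff.tI1 K] (IntDiff.Pol K))) ∧
        iSupIndep L ∧
        IntDiff.asOps K ((⨆ i, L i : Ideal (IntDiff.tI1 K)) : Set (IntDiff.tI1 K)) =
          IntDiff.F K) ∧
      ¬ IsNoetherianRing (IntDiff.tI1 K)) ∧
    -- direct sums of right ideals
    ((∃ R : ℕ → Submodule (IntDiff.tI1 K)ᵐᵒᵖ (IntDiff.tI1 K),
        (∀ i, IntDiff.asOps K (R i) =
          (IntDiff.Erow K i : Set (Module.End K (IntDiff.Pol K))) * IntDiff.I10inv K) ∧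
        (∀ i, (IntDiff.Erow K i : Set (Module.End K (IntDiff.Pol K))) =
          {IntDiff.e K i 0} * (IntDiff.F K : Set (Module.End K (IntDiff.Pol K)))) ∧
        (iSupIndep (IntDiff.Erow K) ∧ ⨆ i, IntDiff.Erow K i = IntDiff.F K) ∧
        (∀ i, R i ≠ ⊥) ∧
        iSupIndep R ∧
        IntDiff.asOps K
          ((⨆ i, R i : Submodule (IntDiff.tI1 K)ᵐᵒᵖ (IntDiff.tI1 K)) : Set (IntDiff.tI1 K)) =
            IntDiff.FS K) ∧
      ¬ IsNoetherianRing (IntDiff.tI1 K)ᵐᵒᵖ) := by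
  refine ⟨⟨IntDiff.I10inv_mul_F, IntDiff.F_ssubset_FS⟩,
    ⟨IntDiff.isRightOreSet_I10, IntDiff.not_isLeftOreSet_I10, IntDiff.isRightQuotientRing_tI1⟩,
    ⟨IntDiff.C K, inferInstance, IntDiff.asOps_C, IntDiff.twoSided_iff_eq_C, IntDiff.C_mul_C,
      IntDiff.isFrac_A1ToQuot, rfl⟩,
    ⟨fun _ => IntDiff.isFredholmMap_of_notMem_compact,
      ⟨_, IntDiff.imageModCompact_mem_fracCandidates⟩, IntDiff.exists_algEquiv_fracV,
      IntDiff.isFrac_A1ToQuot⟩,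
    ⟨IntDiff.isSimpleModule_pol, IntDiff.isSimpleModule_quot, IntDiff.faithfulSMul_pol,
      IntDiff.not_faithfulSMul_quot, IntDiff.isEmpty_pol_equiv_quot,
      fun M _ _ _ => IntDiff.simple_left_classification M⟩,
    ⟨IntDiff.bijective_mk_aeval, IntDiff.rightE K 0, inferInstance, inferInstance,
      IntDiff.quotToRightE K, IntDiff.isRightModuleLocalization_quotToRightE,
      IntDiff.isSimpleModule_rightE, IntDiff.isSimpleModule_quot_right,
      IntDiff.faithfulSMul_rightE, IntDiff.not_faithfulSMul_quot_right,
      IntDiff.isEmpty_rightE_equiv_quot, fun M _ _ _ => IntDiff.simple_right_classification M⟩,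
    ⟨⟨IntDiff.leftE K, IntDiff.asOps_leftE, IntDiff.Ecol_eq_F_mul, IntDiff.leftE_ne_bot,
      fun i => ⟨IntDiff.leftEEquiv K i⟩, IntDiff.iSupIndep_leftE, IntDiff.asOps_iSup_leftE⟩,
      IntDiff.not_isNoetherianRing_tI1⟩,
    ⟨⟨IntDiff.rightE K, IntDiff.asOps_rightE, IntDiff.Erow_eq_mul_F,
      ⟨IntDiff.iSupIndep_Erow, IntDiff.iSup_Erow⟩, IntDiff.rightE_ne_bot,
      IntDiff.iSupIndep_rightE, IntDiff.asOps_iSup_rightE⟩,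
      IntDiff.not_isNoetherianRing_op_tI1⟩⟩
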